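/- **Setting.** Let $\bar L\in\mathbb C^{t\times p}$, $\bar C\in\mathbb C^{t\times n}$, and let $W\in\mathbb C^{p\times n}$ have columns $W_1,\dots,W_n$ of unit Euclidean norm. Let $\bar L=\bar U\bar\Sigma\bar V^\dagger$ be a compact singular value decomposition ($\bar U^\dagger\bar U=\bar V^\dagger\bar V=I_r$, $\bar\Sigma$ diagonal $r\times r$ with positive diagonal). Put $\bar D=\bar C W^T$ and $M=\bar L+\bar D$ (noiseless, fully observed measurements). Let $\bar{\mathcal I}$ be the column support (set of indices of nonzero columns) of $\bar C$, and let $\bar{\mathcal J}$ (the attacked channels) be the column support of $\bar D$. Assume that no nonzero column of $\bar D$ lies in the column space of $\bar L$. Write $\|A\|$ for the spectral norm, $\|A\|_*$ for the nuclear norm, $\|A\|_{1,2}$ and $\|A\|_{\infty,2}$ for the sum and the maximum of the Euclidean norms of the columns of $A$, $A_{\mathcal I}$ for the submatrix of the columns with index in $\mathcal I$, and $W^\ddagger$ for the entrywise conjugate of $W$. Define $$\epsilon=\|\bar V^\dagger W^\ddagger\|_{\infty,2},\qquad \mu=\max_{i\ne j}|W_i^\dagger W_j|,\qquad \sigma_k=\max_{|\mathcal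 I|\le k}\|(W_{\mathcal I}^\dagger W_{\mathcal I})^{-1}\| ,$$ fix $\tilde\psi,c\in(0,1)$ with $(2-\tilde\psi)\sqrt{\tilde\psi}/(1-\tilde\psi)\le\sqrt{(1+c)/(1-c)}$, and put $$\lambda_{\min,k}=\frac{(1+(2-\tilde\psi)^{-1})\,\epsilon}{1-(1+(2-\tilde\psi)^{-1})\,k\sigma_k\mu},\qquad \lambda_{\max,k}=\sqrt{\tilde\psi/(k\sigma_k)} .$$ **Theorem.** Suppose that an integer $\tilde k\ge1$ satisfies $\tilde k\mu\le c$, that the denominator of $\lambda_{\min,\tilde k}$ is positive, and that $\lambda_{\min,\tilde k}\le\lambda_{\max,\tilde k}$. If $|\bar{\mathcal I}|\le\tilde k$, then for every $\lambda\in[\lambda_{\min,\tilde k},\lambda_{\max,\tilde k}]$ the convex program $$\min_{L\in\mathbb C^{t\times p},\,C\in\mathbb C^{t\times n}}\ \|L\|_*+\lambda\|C\|_{1,2}\quad\text{subject to}\quad M=L+CW^T$$ has an optimal solution, and every optimal solution $(L^*,C^*)$, with $\mathcal J^*$ the column support of $C^*W^T$, satisfies: 1. $U^*U^{*\dagger}=\bar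 U\bar U^\dagger$ for every compact singular value decomposition $L^*=U^*\Sigma^*V^{*\dagger}$; 2. $\bar{\mathcal J}\subseteq\mathcal J^*$, and $\mathcal J^*=\bar{\mathcal J}$ provided that the contributions of the attacked columns do not cancel in any channel, i.e. $\bar D_j\ne0$ for every channel $j$ such that $W_{ji}\ne0$ for some $i\in\bar{\mathcal I}$; 3. $L^*_j=\bar L_j$ for every $j\notin\mathcal J^*$ (hence, in the non-cancelling case, $L^*$ and $\bar L$ agree on all the unattacked columns). -/

import Mathlib

namespace AttackId

/-- The `ℓ₂` norm of the `j`-th column of `A`. -/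
noncomputable def colNorm {m n : ℕ} (A : Matrix (Fin m) (Fin n) ℂ) (j : Fin n) : ℝ :=
  ‖WithLp.toLp 2 (A.col j)‖

/-- The nuclear norm: the sum of the singular values. -/
noncomputable def nuclearNorm {m n : ℕ} (A : Matrix (Fin m) (Fin n) ℂ) : ℝ :=
  ∑ i : Fin n, (Matrix.toEuclideanLin A).singularValues i

/-- `‖A‖_{1,2}`: the sum of the `ℓ₂` norms of the columns. -/
noncomputable def norm12 {m n : ℕ} (A : Matrix (Fin m) (Fin n) ℂ) : ℝ :=
  ∑ j, colNorm A j

/-- `‖A‖_{∞,2}`: the largest `ℓ₂` norm of a column (`0` if there is no column). -/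
noncomputable def normInf2 {m n : ℕ} (A : Matrix (Fin m) (Fin n) ℂ) : ℝ :=
  ⨆ j, colNorm A j

/-- The set of indices of the nonzero columns. -/
noncomputable def columnSupport {m n : ℕ} (A : Matrix (Fin m) (Fin n) ℂ) : Finset (Fin n) :=
  open Classical in Finset.univ.filter fun j => A.col j ≠ 0

/-- The column space. -/
noncomputable def columnSpace {m n : ℕ} (A : Matrix (Fin m) (Fin n) ℂ) :
    Submodule ℂ (Fin m → ℂ) :=
  Submodule.span ℂ (Set.range A.col)

/-- `A = U Σ V†` is a (compact) singular value decomposition: `U` and `V` have orthonormal columns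
and `Σ = diag s` with positive diagonal entries. -/
structure IsSVD {m n r : ℕ} (A : Matrix (Fin m) (Fin n) ℂ) (U : Matrix (Fin m) (Fin r) ℂ)
    (s : Fin r → ℝ) (V : Matrix (Fin n) (Fin r) ℂ) : Prop where
  left_orthonormal : U.conjTranspose * U = 1
  right_orthonormal : V.conjTranspose * V = 1
  pos : ∀ i, 0 < s i
  eq : A = U * Matrix.diagonal (fun i => (s i : ℂ)) * V.conjTranspose

/-- `ε = ‖V† W‡‖_{∞,2}`, where `W‡` is the entrywise conjugate of `W`. -/
noncomputable def eps {p n r : ℕ} (V : Matrix (Fin p) (Fin r) ℂ) (W : Matrix (Fin p) (Fin n) ℂ) :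
    ℝ :=
  normInf2 (V.conjTranspose * W.map star)

/-- The coherence `μ = max_{i ≠ j} |W_i† W_j|` (`0` if there are fewer than two columns). -/
noncomputable def coherence {p n : ℕ} (W : Matrix (Fin p) (Fin n) ℂ) : ℝ :=
  ⨆ q : {q : Fin n × Fin n // q.1 ≠ q.2}, ‖(W.conjTranspose * W) q.1.1 q.1.2‖

/-- The submatrix `W_I` of the columns with index in `I`. -/
def columns {p n : ℕ} (W : Matrix (Fin p) (Fin n) ℂ) (I : Finset (Fin n)) : Matrix (Fin p) I ℂ :=
  W.submatrix id Subtype.val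

/-- `σ_k = max_{|I| ≤ k} ‖(W_I† W_I)⁻¹‖`, with the spectral norm. -/
noncomputable def sigma {p n : ℕ} (W : Matrix (Fin p) (Fin n) ℂ) (k : ℕ) : ℝ :=
  ⨆ I : {I : Finset (Fin n) // I.card ≤ k},
    ‖Matrix.toEuclideanCLM (𝕜 := ℂ) ((columns W I.1).conjTranspose * columns W I.1)⁻¹‖

/-- The denominator of `λ_{min,k}`. -/
noncomputable def lambdaMinDenom {p n : ℕ} (ψ : ℝ) (W : Matrix (Fin p) (Fin n) ℂ) (k : ℕ) : ℝ :=
  1 - (1 + (2 - ψ)⁻¹) * k * sigma W k * coherence W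

/-- `λ_{min,k}`. -/
noncomputable def lambdaMin {p n r : ℕ} (ψ : ℝ) (V : Matrix (Fin p) (Fin r) ℂ)
    (W : Matrix (Fin p) (Fin n) ℂ) (k : ℕ) : ℝ :=
  (1 + (2 - ψ)⁻¹) * eps V W / lambdaMinDenom ψ W k

/-- `λ_{max,k}`. -/
noncomputable def lambdaMax {p n : ℕ} (ψ : ℝ) (W : Matrix (Fin p) (Fin n) ℂ) (k : ℕ) : ℝ :=
  √(ψ / (k * sigma W k))

/-- `(L, C)` is an optimal solution of: minimize `‖L‖_* + lam ‖C‖_{1,2}` subject to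
`M = L + C Wᵀ`. -/
structure IsOptimal {t p n : ℕ} (M : Matrix (Fin t) (Fin p) ℂ) (W : Matrix (Fin p) (Fin n) ℂ)
    (lam : ℝ) (L : Matrix (Fin t) (Fin p) ℂ) (C : Matrix (Fin t) (Fin n) ℂ) : Prop where
  feasible : M = L + C * W.transpose
  minimal : ∀ (L' : Matrix (Fin t) (Fin p) ℂ) (C' : Matrix (Fin t) (Fin n) ℂ),
    M = L' + C' * W.transpose →
      nuclearNorm L + lam * norm12 C ≤ nuclearNorm L' + lam * norm12 C'

end AttackId

/-! The pair `(Lbar, Cbar)` need not be optimal: part of the attack lying in the column space of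
`Lbar` can be moved from one term to the other. What survives is the column space and the support,
and this is proved with a dual certificate placed at a different point.

Write `U`, `V` for the singular bases of `Lbar`, `I` for the support of `Cbar`, and `Ω` for the
conjugate of `W_I`. Among the feasible pairs `(Lbar + U A Ωᴴ, Cbar_I - U A)` a best one exists by
coercivity. Hahn–Banach gives multipliers `N`, `Λ` norming its two blocks, with `Uᴴ N Ω = Uᴴ Λ`
(`exists_oracle_dual`). A certificate `Q` for the full program needs `Q Ω = Λ` exactly. Incoherence
keeps the column space equal to that of `U` (`IsSVD.injective_of_incoherent`), so `Vt = Nᴴ U` is an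
isometry. `exists_certificate` then keeps `Uᴴ Q = Vtᴴ` and adds a correction vanishing on the range
of `Vt`. Its norm is at most `√ψ < 1` because `λ² k σ ≤ ψ`.

It remains to bound `Q` strictly by `λ` on the columns of `W‡` outside `I`. Such a column splits as
`Ω b + q` with `q` orthogonal to the range of `Ω`; coherence makes `b` small. The value at `q` is
bounded by the projection of `q` onto `range Vt + range Ω`. This space lies in `range V + range Ω`,
so the incoherence of the known `V` suffices although `Vt` is not explicit
(`norm_sq_le_of_orthogonal`).

By complementary slackness every optimal `L*` has its columns in the range of `U`, and every optimal
`C*` is supported on `I`. Hence `L*` is again of the form `Lbar + U A Ωᴴ`, and incoherence gives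
equality of column spaces. The claims on channels follow column by column from the hypothesis on
`Cbar Wᵀ`. If `λ = 0`, then `ε = 0` and `U Vᴴ` itself is a certificate. -/

namespace AttackId
open Matrix

/-! ### Nuclear norm: singular value decompositions and duality with the spectral norm. -/

section NuclearNorm

/-- The real inner product `Re tr (Q† A)` of two matrices. -/
noncomputable def pairing {m n : Type*} [Fintype m] [Fintype n] (Q A : Matrix m n ℂ) : ℝ :=
  (Qᴴ * A).trace.re

/-- The spectral norm is at most one. -/
def IsContraction {m n : Type*} [Fintype m] [Fintype n] [DecidableEq n] (Q : Matrix m n ℂ) :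
    Prop :=
  ∀ x, ‖Q.toEuclideanLin x‖ ≤ ‖x‖

theorem pairing_eq_sum {m n : Type*} [Fintype m] [Fintype n] (Q A : Matrix m n ℂ) :
    pairing Q A = ∑ j, (inner ℂ (WithLp.toLp 2 (Q.col j)) (WithLp.toLp 2 (A.col j))).re := by
  simp [pairing, Matrix.trace, Matrix.mul_apply, PiLp.inner_apply, mul_comm]

theorem pairing_add_right {m n : Type*} [Fintype m] [Fintype n] (Q A B : Matrix m n ℂ) :
    pairing Q (A + B) = pairing Q A + pairing Q B := by
  simp [pairing, Matrix.mul_add]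

theorem pairing_sub_right {m n : Type*} [Fintype m] [Fintype n] (Q A B : Matrix m n ℂ) :
    pairing Q (A - B) = pairing Q A - pairing Q B := by
  simp [pairing, Matrix.mul_sub]

theorem pairing_sub_left {m n : Type*} [Fintype m] [Fintype n] (P Q A : Matrix m n ℂ) :
    pairing (P - Q) A = pairing P A - pairing Q A := by
  simp [pairing, Matrix.sub_mul]

theorem pairing_smul_right {m n : Type*} [Fintype m] [Fintype n] (Q A : Matrix m n ℂ) (c : ℝ) :
    pairing Q (c • A) = c * pairing Q A := by
  simp [pairing]

theorem pairing_mul_left {m n l : Type*} [Fintype m] [Fintype n] [Fintype l]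
    (Q : Matrix m n ℂ) (B : Matrix m l ℂ) (A : Matrix l n ℂ) :
    pairing Q (B * A) = pairing (Bᴴ * Q) A := by
  simp [pairing, Matrix.mul_assoc]

theorem pairing_mul_right {m n l : Type*} [Fintype m] [Fintype n] [Fintype l]
    (Q : Matrix m n ℂ) (A : Matrix m l ℂ) (B : Matrix l n ℂ) :
    pairing Q (A * B) = pairing (Q * Bᴴ) A := by
  simp only [pairing, Matrix.conjTranspose_mul, Matrix.conjTranspose_conjTranspose]
  rw [← Matrix.mul_assoc, Matrix.trace_mul_comm, Matrix.mul_assoc]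

theorem continuous_pairing {m n : Type*} [Fintype m] [Fintype n] (Q : Matrix m n ℂ) :
    Continuous (pairing Q) := by
  unfold pairing
  fun_prop

theorem toEuclideanLin_mul_apply {m n l : Type*} [Fintype n] [Fintype l] [DecidableEq n]
    [DecidableEq l] (A : Matrix m n ℂ) (B : Matrix n l ℂ) (x : EuclideanSpace ℂ l) :
    (A * B).toEuclideanLin x = A.toEuclideanLin (B.toEuclideanLin x) := by
  rw [Matrix.toLpLin_mul 2 2 2 A B]; rfl

theorem inner_toEuclideanLin_left {m n : Type*} [Fintype m] [Fintype n] [DecidableEq n]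
    [DecidableEq m] (A : Matrix m n ℂ) (x : EuclideanSpace ℂ n) (y : EuclideanSpace ℂ m) :
    inner ℂ (A.toEuclideanLin x) y = inner ℂ x (Aᴴ.toEuclideanLin y) := by
  rw [Matrix.toEuclideanLin_conjTranspose_eq_adjoint, LinearMap.adjoint_inner_right]

theorem norm_toEuclideanLin_of_isometry {m n : Type*} [Fintype m] [Fintype n] [DecidableEq n]
    {U : Matrix m n ℂ} (hU : Uᴴ * U = 1) (x : EuclideanSpace ℂ n) :
    ‖U.toEuclideanLin x‖ = ‖x‖ := by
  classical
  have h : inner ℂ (U.toEuclideanLin x) (U.toEuclideanLin x) = inner ℂ x x := by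
    rw [inner_toEuclideanLin_left, ← toEuclideanLin_mul_apply, hU, Matrix.toLpLin_one]; rfl
  rw [inner_self_eq_norm_sq_to_K, inner_self_eq_norm_sq_to_K] at h
  have h' : ‖U.toEuclideanLin x‖ ^ 2 = ‖x‖ ^ 2 := by exact_mod_cast h
  exact (sq_eq_sq₀ (norm_nonneg _) (norm_nonneg _)).1 h'

theorem norm_conjTranspose_of_isometry_le {m n : Type*} [Fintype m] [Fintype n] [DecidableEq n]
    [DecidableEq m] {U : Matrix m n ℂ} (hU : Uᴴ * U = 1) (x : EuclideanSpace ℂ m) :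
    ‖Uᴴ.toEuclideanLin x‖ ≤ ‖x‖ := by
  have h : inner ℂ (Uᴴ.toEuclideanLin x) (Uᴴ.toEuclideanLin x)
      = inner ℂ x (U.toEuclideanLin (Uᴴ.toEuclideanLin x)) := by
    rw [inner_toEuclideanLin_left, conjTranspose_conjTranspose]
  have h2 : ‖Uᴴ.toEuclideanLin x‖ ^ 2 ≤ ‖x‖ * ‖Uᴴ.toEuclideanLin x‖ := by
    have := norm_inner_le_norm (𝕜 := ℂ) x (U.toEuclideanLin (Uᴴ.toEuclideanLin x))
    rw [← h, norm_toEuclideanLin_of_isometry hU, inner_self_eq_norm_sq_to_K] at this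
    simpa using this
  nlinarith [norm_nonneg (Uᴴ.toEuclideanLin x), norm_nonneg x]

theorem toLp_col_mul {m n l : Type*} [Fintype m] [Fintype n] [DecidableEq n]
    (A : Matrix m n ℂ) (B : Matrix n l ℂ) (j : l) :
    WithLp.toLp 2 ((A * B).col j) = A.toEuclideanLin (WithLp.toLp 2 (B.col j)) := by
  ext i
  simp [Matrix.mul_apply, Matrix.mulVec, dotProduct]

theorem norm_col_of_isometry {m n : Type*} [Fintype m] [Fintype n] [DecidableEq n]
    {U : Matrix m n ℂ} (hU : Uᴴ * U = 1) (j : n) : ‖WithLp.toLp 2 (U.col j)‖ = 1 := by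
  have h := toLp_col_mul U (1 : Matrix n n ℂ) j
  rw [Matrix.mul_one] at h
  have h1 : WithLp.toLp 2 ((1 : Matrix n n ℂ).col j) = EuclideanSpace.single j 1 := by
    ext i
    simp [Matrix.one_apply]
  rw [h, norm_toEuclideanLin_of_isometry hU, h1]
  simp

theorem sum_subtype_ne_zero {ι M : Type*} [Fintype ι] [AddCommMonoid M] (σ : ι → ℝ)
    [Fintype {i // σ i ≠ 0}] (f : ι → M) (h : ∀ i, σ i = 0 → f i = 0) :
    ∑ i : {i // σ i ≠ 0}, f i = ∑ i, f i := by
  classical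
  rw [← Finset.sum_subtype (Finset.univ.filter fun i => σ i ≠ 0) (by simp) f,
    Finset.sum_filter_of_ne]
  exact fun i _ hi hσ => hi (h i hσ)

/-- Diagonalise `T* T`: the images of its eigenvectors `b i` are orthogonal of lengths `σ i`.
Discarding the indices with `σ i = 0` and normalising the other images gives the left factor. -/
theorem exists_isSVD {m n : ℕ} (A : Matrix (Fin m) (Fin n) ℂ) :
    ∃ (r : ℕ) (U : Matrix (Fin m) (Fin r) ℂ) (s : Fin r → ℝ) (V : Matrix (Fin n) (Fin r) ℂ),
      IsSVD A U s V ∧ nuclearNorm A = ∑ i, s i := by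
  classical
  set T := A.toEuclideanLin with hT
  have hn : Module.finrank ℂ (EuclideanSpace ℂ (Fin n)) = n := by simp
  set b := T.isSymmetric_adjoint_comp_self.eigenvectorBasis hn with hb
  set σ : Fin n → ℝ := fun i => T.singularValues i with hσ
  have hσ0 : ∀ i, 0 ≤ σ i := fun i => T.singularValues_nonneg i
  have hTT : ∀ i j, inner ℂ (T (b i)) (T (b j)) = if i = j then ((σ j : ℂ)) ^ 2 else 0 := by
    intro i j
    have h1 : (LinearMap.adjoint T ∘ₗ T) (b j) = ((σ j ^ 2 : ℝ) : ℂ) • b j := by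
      rw [hσ, hb]
      simp only [T.sq_singularValues_fin hn]
      exact T.isSymmetric_adjoint_comp_self.apply_eigenvectorBasis hn j
    rw [← LinearMap.adjoint_inner_right, ← LinearMap.comp_apply, h1, inner_smul_right,
      b.inner_eq_ite]
    split_ifs <;> simp
  have hT0 : ∀ i, σ i = 0 → T (b i) = 0 := by
    intro i hi
    have := hTT i i
    rw [if_pos rfl, hi] at this
    simpa using this
  have hA : ∀ a c, A a c = ∑ i, T (b i) a * star (b i c) := by
    intro a c
    have h1 : A a c = T (EuclideanSpace.single c 1) a := by simp [hT]
    rw [h1, ← b.sum_repr (EuclideanSpace.single c 1)]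
    simp only [map_sum, map_smul, b.repr_apply_apply]
    rw [WithLp.ofLp_sum, Finset.sum_apply]
    refine Finset.sum_congr rfl fun i _ => ?_
    simp [PiLp.inner_apply, mul_comm]
  let J := {i : Fin n // σ i ≠ 0}
  let e : Fin (Fintype.card J) ≃ J := (Fintype.equivFin J).symm
  refine ⟨Fintype.card J, Matrix.of fun a k => (σ (e k) : ℂ)⁻¹ * T (b (e k)) a,
    fun k => σ (e k), Matrix.of fun a k => b (e k) a, ⟨?_, ?_, ?_, ?_⟩, ?_⟩
  · ext k l
    have h := hTT (e k) (e l)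
    simp only [PiLp.inner_apply, RCLike.inner_apply] at h
    have h2 : (Matrix.conjTranspose (Matrix.of fun a k => (σ (e k) : ℂ)⁻¹ * T (b (e k)) a) *
        (Matrix.of fun a k => (σ (e k) : ℂ)⁻¹ * T (b (e k)) a)) k l
        = (σ (e k) : ℂ)⁻¹ * (σ (e l) : ℂ)⁻¹ *
          ∑ i, (T (b (e l))) i * (starRingEnd ℂ) ((T (b (e k))) i) := by
      simp only [Matrix.mul_apply, Matrix.conjTranspose_apply, Matrix.of_apply, Finset.mul_sum]
      refine Finset.sum_congr rfl fun i _ => ?_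
      simp
      ring
    rw [h2, h, Matrix.one_apply]
    by_cases hkl : k = l
    · subst hkl
      have : (σ (e k) : ℂ) ≠ 0 := by exact_mod_cast (e k).2
      simp; field_simp
    · have : (e k : Fin n) ≠ e l := fun h => hkl (e.injective (Subtype.ext h))
      simp [hkl, this]
  · ext k l
    have h := b.inner_eq_ite (e k) (e l)
    simp only [PiLp.inner_apply, RCLike.inner_apply] at h
    simp only [Matrix.mul_apply, Matrix.conjTranspose_apply, Matrix.of_apply, Matrix.one_apply]
    have : (e k : Fin n) = e l ↔ k = l := by
      rw [← Subtype.ext_iff]; exact e.injective.eq_iff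
    simp only [this] at h
    rw [← h]
    exact Finset.sum_congr rfl fun i _ => by simp [mul_comm]
  · intro k
    exact lt_of_le_of_ne (hσ0 _) (Ne.symm (e k).2)
  · ext a c
    rw [hA, Matrix.mul_apply]
    simp only [Matrix.mul_diagonal, Matrix.conjTranspose_apply, Matrix.of_apply]
    rw [Equiv.sum_comp e (fun i : J => (σ i : ℂ)⁻¹ * T (b i) a * (σ i : ℂ) * star (b i c)),
      sum_subtype_ne_zero σ (fun i => (σ i : ℂ)⁻¹ * T (b i) a * (σ i : ℂ) * star (b i c))
        (fun i hi => by simp [hi])]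
    refine Finset.sum_congr rfl fun i _ => ?_
    by_cases hi : σ i = 0
    · simp [hT0 i hi]
    · have : (σ i : ℂ) ≠ 0 := by exact_mod_cast hi
      field_simp
  · rw [Equiv.sum_comp e (fun i : J => σ i), sum_subtype_ne_zero σ σ (fun i hi => hi)]
    rfl

theorem IsSVD.pairing_eq {m n r : ℕ} {A : Matrix (Fin m) (Fin n) ℂ} {U : Matrix (Fin m) (Fin r) ℂ}
    {s : Fin r → ℝ} {V : Matrix (Fin n) (Fin r) ℂ} (h : IsSVD A U s V)
    (Q : Matrix (Fin m) (Fin n) ℂ) :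
    pairing Q A = ∑ i, s i * (inner ℂ (Q.toEuclideanLin (WithLp.toLp 2 (V.col i)))
      (WithLp.toLp 2 (U.col i))).re := by
  rw [h.eq, pairing_mul_right, conjTranspose_conjTranspose, pairing_eq_sum]
  refine Finset.sum_congr rfl fun i _ => ?_
  have : WithLp.toLp 2 ((U * Matrix.diagonal fun i => (s i : ℂ)).col i)
      = (s i : ℂ) • WithLp.toLp 2 (U.col i) := by
    ext a; simp [mul_comm]
  rw [this, inner_smul_right, toLp_col_mul, Complex.re_ofReal_mul]

theorem IsSVD.re_inner_le_one {m n r : ℕ} {A : Matrix (Fin m) (Fin n) ℂ}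
    {U : Matrix (Fin m) (Fin r) ℂ} {s : Fin r → ℝ} {V : Matrix (Fin n) (Fin r) ℂ}
    (h : IsSVD A U s V) {Q : Matrix (Fin m) (Fin n) ℂ} (hQ : IsContraction Q) (i : Fin r) :
    (inner ℂ (Q.toEuclideanLin (WithLp.toLp 2 (V.col i))) (WithLp.toLp 2 (U.col i))).re ≤ 1 := by
  have h1 := hQ (WithLp.toLp 2 (V.col i))
  have h2 := re_inner_le_norm (𝕜 := ℂ) (Q.toEuclideanLin (WithLp.toLp 2 (V.col i)))
    (WithLp.toLp 2 (U.col i))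
  rw [norm_col_of_isometry h.left_orthonormal, mul_one] at h2
  rw [norm_col_of_isometry h.right_orthonormal] at h1
  exact h2.trans h1

theorem IsSVD.pairing_le {m n r : ℕ} {A : Matrix (Fin m) (Fin n) ℂ}
    {U : Matrix (Fin m) (Fin r) ℂ} {s : Fin r → ℝ} {V : Matrix (Fin n) (Fin r) ℂ}
    (h : IsSVD A U s V) {Q : Matrix (Fin m) (Fin n) ℂ} (hQ : IsContraction Q) :
    pairing Q A ≤ ∑ i, s i := by
  rw [h.pairing_eq]
  refine Finset.sum_le_sum fun i _ => ?_
  have := mul_le_mul_of_nonneg_left (h.re_inner_le_one hQ i) (h.pos i).le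
  simpa using this

/-- Equality in the duality bound is equality in every term, as all weights `s i` are positive. A
vector of norm at most one whose inner product with a unit vector has real part one equals that
vector. -/
theorem IsSVD.mul_eq_of_pairing_eq {m n r : ℕ} {A : Matrix (Fin m) (Fin n) ℂ}
    {U : Matrix (Fin m) (Fin r) ℂ} {s : Fin r → ℝ} {V : Matrix (Fin n) (Fin r) ℂ}
    (h : IsSVD A U s V) {Q : Matrix (Fin m) (Fin n) ℂ} (hQ : IsContraction Q)
    (hQA : pairing Q A = ∑ i, s i) : Q * V = U := by
  rw [h.pairing_eq] at hQA
  have h1 := (Finset.sum_eq_sum_iff_of_le (fun i _ => by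
    have := mul_le_mul_of_nonneg_left (h.re_inner_le_one hQ i) (h.pos i).le
    simpa using this)).1 hQA
  have key : ∀ i, Q.toEuclideanLin (WithLp.toLp 2 (V.col i)) = WithLp.toLp 2 (U.col i) := by
    intro i
    have h2 : (inner ℂ (Q.toEuclideanLin (WithLp.toLp 2 (V.col i)))
        (WithLp.toLp 2 (U.col i))).re = 1 := by
      have := h1 i (Finset.mem_univ i)
      exact mul_left_cancel₀ (h.pos i).ne' (by rw [this, mul_one])
    have h3 := hQ (WithLp.toLp 2 (V.col i))
    rw [norm_col_of_isometry h.right_orthonormal] at h3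
    have h4 := @norm_sub_sq ℂ _ _ _ _ (Q.toEuclideanLin (WithLp.toLp 2 (V.col i)))
      (WithLp.toLp 2 (U.col i))
    rw [norm_col_of_isometry h.left_orthonormal] at h4
    have h5 : RCLike.re (inner ℂ (Q.toEuclideanLin (WithLp.toLp 2 (V.col i)))
        (WithLp.toLp 2 (U.col i))) = 1 := h2
    rw [h5] at h4
    have h6 : ‖Q.toEuclideanLin (WithLp.toLp 2 (V.col i)) - WithLp.toLp 2 (U.col i)‖ = 0 := by
      have := norm_nonneg (Q.toEuclideanLin (WithLp.toLp 2 (V.col i)) - WithLp.toLp 2 (U.col i))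
      nlinarith [norm_nonneg (Q.toEuclideanLin (WithLp.toLp 2 (V.col i)))]
    exact sub_eq_zero.1 (norm_eq_zero.1 h6)
  ext a i
  have := congrArg (fun v => v.ofLp a) ((toLp_col_mul Q V i).trans (key i))
  simpa using this

theorem IsSVD.mul_conjTranspose_isContraction {m n r : ℕ} {A : Matrix (Fin m) (Fin n) ℂ}
    {U : Matrix (Fin m) (Fin r) ℂ} {s : Fin r → ℝ} {V : Matrix (Fin n) (Fin r) ℂ}
    (h : IsSVD A U s V) : IsContraction (U * Vᴴ) := by
  intro x
  rw [toEuclideanLin_mul_apply, norm_toEuclideanLin_of_isometry h.left_orthonormal]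
  exact norm_conjTranspose_of_isometry_le h.right_orthonormal x

theorem IsSVD.pairing_mul_conjTranspose {m n r : ℕ} {A : Matrix (Fin m) (Fin n) ℂ}
    {U : Matrix (Fin m) (Fin r) ℂ} {s : Fin r → ℝ} {V : Matrix (Fin n) (Fin r) ℂ}
    (h : IsSVD A U s V) : pairing (U * Vᴴ) A = ∑ i, s i := by
  rw [h.pairing_eq]
  refine Finset.sum_congr rfl fun i _ => ?_
  rw [← toLp_col_mul, Matrix.mul_assoc, h.right_orthonormal, Matrix.mul_one,
    inner_self_eq_norm_sq_to_K, norm_col_of_isometry h.left_orthonormal]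
  simp

/-- For any decomposition the sum of the `s i` is the maximum of the pairing over contractions,
attained at `U Vᴴ`, so it does not depend on the decomposition. -/
theorem IsSVD.nuclearNorm_eq {m n r : ℕ} {A : Matrix (Fin m) (Fin n) ℂ}
    {U : Matrix (Fin m) (Fin r) ℂ} {s : Fin r → ℝ} {V : Matrix (Fin n) (Fin r) ℂ}
    (h : IsSVD A U s V) : nuclearNorm A = ∑ i, s i := by
  obtain ⟨r', U', s', V', h', hA⟩ := exists_isSVD A
  rw [hA]
  refine le_antisymm ?_ ?_
  · rw [← h'.pairing_mul_conjTranspose]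
    exact h.pairing_le h'.mul_conjTranspose_isContraction
  · rw [← h.pairing_mul_conjTranspose]
    exact h'.pairing_le h.mul_conjTranspose_isContraction

theorem pairing_le_nuclearNorm {m n : ℕ} {Q : Matrix (Fin m) (Fin n) ℂ} (hQ : IsContraction Q)
    (A : Matrix (Fin m) (Fin n) ℂ) : pairing Q A ≤ nuclearNorm A := by
  obtain ⟨r, U, s, V, h, hA⟩ := exists_isSVD A
  exact hA ▸ h.pairing_le hQ

theorem exists_pairing_eq_nuclearNorm {m n : ℕ} (A : Matrix (Fin m) (Fin n) ℂ) :
    ∃ Q, IsContraction Q ∧ pairing Q A = nuclearNorm A := by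
  obtain ⟨r, U, s, V, h, hA⟩ := exists_isSVD A
  exact ⟨_, h.mul_conjTranspose_isContraction, by rw [hA, h.pairing_mul_conjTranspose]⟩

theorem nuclearNorm_nonneg {m n : ℕ} (A : Matrix (Fin m) (Fin n) ℂ) : 0 ≤ nuclearNorm A :=
  Finset.sum_nonneg fun _ _ => LinearMap.singularValues_nonneg _ _

theorem nuclearNorm_add_le {m n : ℕ} (A B : Matrix (Fin m) (Fin n) ℂ) :
    nuclearNorm (A + B) ≤ nuclearNorm A + nuclearNorm B := by
  obtain ⟨Q, hQ, h⟩ := exists_pairing_eq_nuclearNorm (A + B)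
  rw [← h, pairing_add_right]
  exact add_le_add (pairing_le_nuclearNorm hQ A) (pairing_le_nuclearNorm hQ B)

theorem nuclearNorm_smul {m n : ℕ} (A : Matrix (Fin m) (Fin n) ℂ) {c : ℝ} (hc : 0 < c) :
    nuclearNorm (c • A) = c * nuclearNorm A := by
  have key : ∀ (d : ℝ) (B : Matrix (Fin m) (Fin n) ℂ), 0 < d →
      nuclearNorm (d • B) ≤ d * nuclearNorm B := by
    intro d B hd
    obtain ⟨Q, hQ, h⟩ := exists_pairing_eq_nuclearNorm (d • B)
    rw [← h, pairing_smul_right]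
    exact mul_le_mul_of_nonneg_left (pairing_le_nuclearNorm hQ B) hd.le
  refine le_antisymm (key c A hc) ?_
  have := key c⁻¹ (c • A) (inv_pos.2 hc)
  rw [smul_smul, inv_mul_cancel₀ hc.ne', one_smul] at this
  calc c * nuclearNorm A ≤ c * (c⁻¹ * nuclearNorm (c • A)) := by gcongr
    _ = nuclearNorm (c • A) := by field_simp

/-- A supremum of continuous pairings is lower semicontinuous; this is all that the existence of
minimisers needs. -/
theorem lowerSemicontinuous_nuclearNorm {m n : ℕ} :
    LowerSemicontinuous (nuclearNorm : Matrix (Fin m) (Fin n) ℂ → ℝ) := by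
  intro A y hy
  obtain ⟨Q, hQ, h⟩ := exists_pairing_eq_nuclearNorm A
  rw [← h] at hy
  filter_upwards [(continuous_pairing Q).continuousAt.eventually_const_lt hy] with B hB
  exact hB.trans_le (pairing_le_nuclearNorm hQ B)

end NuclearNorm

/-! ### Hahn–Banach multipliers for the oracle problem. -/

section Duality

/-- This is first-order optimality as a separation statement: on `S + ℝ x`, the functional killing
`S` and equal to `N x` at `x` is dominated by `N` exactly because `x` minimises `N` on `x + S`.
Hahn–Banach extends it. -/
theorem exists_norming_functional {E : Type*} [AddCommGroup E] [Module ℝ E] (S : Submodule ℝ E)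
    (N : E → ℝ) (N_hom : ∀ c : ℝ, 0 < c → ∀ x, N (c • x) = c * N x)
    (N_add : ∀ x y, N (x + y) ≤ N x + N y) (N_nonneg : ∀ x, 0 ≤ N x) (x : E)
    (hx : ∀ s ∈ S, N x ≤ N (x + s)) :
    ∃ g : E →ₗ[ℝ] ℝ, (∀ y, g y ≤ N y) ∧ (∀ s ∈ S, g s = 0) ∧ g x = N x := by
  by_cases hxS : x ∈ S
  · have h0 : N 0 = 0 := by
      have := N_hom 2 two_pos 0
      rw [smul_zero] at this
      linarith
    have h1 := hx (-x) (S.neg_mem hxS)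
    rw [add_neg_cancel, h0] at h1
    exact ⟨0, by simpa using N_nonneg, by simp, by simp [le_antisymm h1 (N_nonneg x)]⟩
  · obtain ⟨f, hf, hfS⟩ := Submodule.exists_le_ker_of_notMem hxS
    have hfS' : ∀ s ∈ S, f s = 0 := fun s hs => by simpa using hfS hs
    let f' : E →ₗ[ℝ] ℝ := (N x / f x) • f
    have hf'x : f' x = N x := by simp [f', div_mul_cancel₀ _ hf]
    have hf'S : ∀ s ∈ S, f' s = 0 := fun s hs => by simp [f', hfS' s hs]
    let D : Submodule ℝ E := S ⊔ Submodule.span ℝ {x}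
    obtain ⟨g, hg, hgN⟩ := exists_extension_of_le_sublinear ⟨D, f'.domRestrict D⟩ N N_hom N_add
      (by
        rintro ⟨y, hy⟩
        obtain ⟨s, hs, z, hz, rfl⟩ := Submodule.mem_sup.1 hy
        obtain ⟨a, rfl⟩ := Submodule.mem_span_singleton.1 hz
        change f' (s + a • x) ≤ N (s + a • x)
        rw [map_add, map_smul, hf'S s hs, hf'x, zero_add, smul_eq_mul]
        -- For `a ≤ 0` the functional is nonpositive and `N` is not; for `a > 0`, rescaling by `a`
        -- reduces to minimality at `x`.
        rcases le_or_gt a 0 with ha | ha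
        · exact (mul_nonpos_of_nonpos_of_nonneg ha (N_nonneg x)).trans (N_nonneg _)
        · have h1 := hx (a⁻¹ • s) (S.smul_mem _ hs)
          have h2 := N_hom a ha (x + a⁻¹ • s)
          rw [smul_add, smul_smul, mul_inv_cancel₀ ha.ne', one_smul, add_comm] at h2
          rw [h2]
          exact mul_le_mul_of_nonneg_left h1 ha.le)
    have hgD : ∀ y ∈ D, g y = f' y := fun y hy => hg ⟨y, hy⟩
    refine ⟨g, hgN, fun s hs => ?_, ?_⟩
    · rw [hgD s (Submodule.mem_sup_left hs), hf'S s hs]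
    · rw [hgD x (Submodule.mem_sup_right (Submodule.mem_span_singleton_self x)), hf'x]

theorem exists_pairing_eq {m n : Type*} [Fintype m] [Fintype n]
    (g : Matrix m n ℂ →ₗ[ℝ] ℝ) : ∃ Q : Matrix m n ℂ, ∀ A, g A = pairing Q A := by
  classical
  -- Only real linearity is available, so the real and imaginary parts of each entry of `Q` are read
  -- off from the units `1` and `I`.
  refine ⟨Matrix.of fun i j => (g (Matrix.single i j 1) : ℂ) +
    (g (Matrix.single i j Complex.I) : ℂ) * Complex.I, fun A => ?_⟩
  have h1 : ∀ i j, g (Matrix.single i j (A i j)) =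
      (A i j).re * g (Matrix.single i j 1) + (A i j).im * g (Matrix.single i j Complex.I) := by
    intro i j
    rw [← smul_eq_mul, ← smul_eq_mul, ← map_smul, ← map_smul, ← map_add]
    congr 1
    ext a b
    simp only [Matrix.add_apply, Matrix.smul_apply, Matrix.single_apply]
    split_ifs
    · simp
    · simp
  conv_lhs => rw [Matrix.matrix_eq_sum_single A]
  simp only [map_sum, h1]
  rw [pairing_eq_sum, Finset.sum_comm]
  refine Finset.sum_congr rfl fun j _ => ?_
  rw [PiLp.inner_apply, Complex.re_sum]
  refine Finset.sum_congr rfl fun i _ => ?_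
  simp

theorem eq_zero_of_pairing_eq_zero {m n : Type*} [Fintype m] [Fintype n] {Q : Matrix m n ℂ}
    (h : ∀ A, pairing Q A = 0) : Q = 0 := by
  have h1 := h Q
  simp only [pairing_eq_sum] at h1
  have h3 : ∀ v : EuclideanSpace ℂ m, (inner ℂ v v).re = ‖v‖ ^ 2 := fun v => by
    rw [inner_self_eq_norm_sq_to_K]; norm_cast
  simp only [h3] at h1
  rw [Finset.sum_eq_zero_iff_of_nonneg (fun j _ => sq_nonneg _)] at h1
  ext i j
  have h2 : WithLp.toLp 2 (Q.col j) = 0 := by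
    simpa using h1 j (Finset.mem_univ j)
  simpa using congrArg (fun v => v.ofLp i) h2

theorem pairing_vecMulVec {m n : Type*} [Fintype m] [Fintype n] [DecidableEq n]
    (Q : Matrix m n ℂ) (x : EuclideanSpace ℂ n) (y : EuclideanSpace ℂ m) :
    pairing Q (Matrix.vecMulVec y (star x.ofLp)) = (inner ℂ (Q.toEuclideanLin x) y).re := by
  rw [pairing_eq_sum, ← Complex.re_sum]
  congr 1
  simp only [PiLp.inner_apply, Matrix.col_apply, Matrix.vecMulVec_apply, RCLike.inner_apply,
    Matrix.toLpLin_apply, Matrix.mulVec, dotProduct, map_sum, Finset.mul_sum, map_mul]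
  rw [Finset.sum_comm]
  refine Finset.sum_congr rfl fun i _ => Finset.sum_congr rfl fun j _ => ?_
  simp
  ring

/-- Test on the rank one matrix `y x†` with `y = Q x`: the pairing is `‖y‖²`, while a norming
contraction bounds the nuclear norm by `‖x‖ ‖y‖`. -/
theorem isContraction_of_pairing_le {m n : ℕ} {Q : Matrix (Fin m) (Fin n) ℂ}
    (h : ∀ A, pairing Q A ≤ nuclearNorm A) : IsContraction Q := by
  intro x
  set y := Q.toEuclideanLin x with hy
  obtain ⟨P, hP, hPA⟩ := exists_pairing_eq_nuclearNorm (Matrix.vecMulVec y (star x.ofLp))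
  have h1 := h (Matrix.vecMulVec y (star x.ofLp))
  rw [← hPA, pairing_vecMulVec, pairing_vecMulVec, ← hy] at h1
  have h2 : (inner ℂ y y).re = ‖y‖ ^ 2 := by
    rw [inner_self_eq_norm_sq_to_K]; norm_cast
  have h3 : (inner ℂ (P.toEuclideanLin x) y).re ≤ ‖P.toEuclideanLin x‖ * ‖y‖ :=
    re_inner_le_norm (𝕜 := ℂ) _ _
  have h4 := mul_le_mul_of_nonneg_right (hP x) (norm_nonneg y)
  rw [h2] at h1
  by_contra hlt
  nlinarith [norm_nonneg x, norm_nonneg y]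

theorem norm_le_of_forall_re_inner_le {E : Type*} [NormedAddCommGroup E] [InnerProductSpace ℂ E]
    {v : E} {c : ℝ} (hc : 0 ≤ c) (h : ∀ w : E, (inner ℂ v w).re ≤ c * ‖w‖) : ‖v‖ ≤ c := by
  have h1 := h v
  have h2 : (inner ℂ v v).re = ‖v‖ ^ 2 := by
    rw [inner_self_eq_norm_sq_to_K]; norm_cast
  rw [h2] at h1
  by_contra hlt
  nlinarith [norm_nonneg v]

/-- The sum of the Euclidean norms of the columns, for an arbitrary column index. -/
noncomputable def columnSum {m ι : Type*} [Fintype m] [Fintype ι] (A : Matrix m ι ℂ) : ℝ :=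
  ∑ i, ‖WithLp.toLp 2 (A.col i)‖

theorem columnSum_nonneg {m ι : Type*} [Fintype m] [Fintype ι] (A : Matrix m ι ℂ) :
    0 ≤ columnSum A :=
  Finset.sum_nonneg fun _ _ => norm_nonneg _

theorem norm_col_le_columnSum {m ι : Type*} [Fintype m] [Fintype ι] (A : Matrix m ι ℂ) (i : ι) :
    ‖WithLp.toLp 2 (A.col i)‖ ≤ columnSum A :=
  Finset.single_le_sum (f := fun i => ‖WithLp.toLp 2 (A.col i)‖) (fun _ _ => norm_nonneg _)
    (Finset.mem_univ i)

theorem columnSum_add_le {m ι : Type*} [Fintype m] [Fintype ι] (A B : Matrix m ι ℂ) :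
    columnSum (A + B) ≤ columnSum A + columnSum B := by
  unfold columnSum
  rw [← Finset.sum_add_distrib]
  exact Finset.sum_le_sum fun i _ => norm_add_le (WithLp.toLp 2 (A.col i)) (WithLp.toLp 2 (B.col i))

theorem columnSum_smul {m ι : Type*} [Fintype m] [Fintype ι] (A : Matrix m ι ℂ) {c : ℝ}
    (hc : 0 < c) : columnSum (c • A) = c * columnSum A := by
  unfold columnSum
  rw [Finset.mul_sum]
  refine Finset.sum_congr rfl fun i _ => ?_
  have : WithLp.toLp 2 ((c • A).col i) = c • WithLp.toLp 2 (A.col i) := by ext; simp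
  rw [this, norm_smul, Real.norm_of_nonneg hc.le]

theorem continuous_columnSum {m ι : Type*} [Fintype m] [Fintype ι] :
    Continuous (columnSum : Matrix m ι ℂ → ℝ) := by
  unfold columnSum
  refine continuous_finsetSum _ fun i _ => ?_
  refine ((PiLp.continuous_toLp 2 _).comp ?_).norm
  exact continuous_pi fun a => (continuous_apply i).comp (continuous_apply a)

theorem exists_forall_nuclearNorm_add_columnSum_le {t p r : ℕ} {ι : Type*} [Fintype ι]
    {U : Matrix (Fin t) (Fin r) ℂ} (hU : Uᴴ * U = 1) (L : Matrix (Fin t) (Fin p) ℂ)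
    (C : Matrix (Fin t) ι ℂ) (B : Matrix ι (Fin p) ℂ) {lam : ℝ} (hlam : 0 < lam) :
    ∃ A : Matrix (Fin r) ι ℂ, ∀ A' : Matrix (Fin r) ι ℂ,
      nuclearNorm (L + U * A * B) + lam * columnSum (C - U * A) ≤
        nuclearNorm (L + U * A' * B) + lam * columnSum (C - U * A') := by
  set F : Matrix (Fin r) ι ℂ → ℝ := fun A =>
    nuclearNorm (L + U * A * B) + lam * columnSum (C - U * A) with hF
  -- Since `U` preserves column norms, an entry of `A'` larger than `R` forces `lam * columnSum (C -
  -- U * A') > F 0`; minimising over the box of radius `R` is therefore enough.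
  set R : ℝ := F 0 / lam + columnSum C with hR
  have hF0 : 0 ≤ F 0 :=
    add_nonneg (nuclearNorm_nonneg _) (mul_nonneg hlam.le (columnSum_nonneg _))
  have hR0 : 0 ≤ R := add_nonneg (div_nonneg hF0 hlam.le) (columnSum_nonneg _)
  let K : Set (Matrix (Fin r) ι ℂ) :=
    Set.univ.pi fun _ => Set.univ.pi fun _ => Metric.closedBall (0 : ℂ) R
  have hK : IsCompact K :=
    isCompact_univ_pi fun _ => isCompact_univ_pi fun _ => isCompact_closedBall _ _
  have hlsc : LowerSemicontinuous F := by
    refine LowerSemicontinuous.add ?_ ?_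
    · exact lowerSemicontinuous_nuclearNorm.comp (g := fun A => L + U * A * B) (by fun_prop)
    · exact (continuous_const.mul (continuous_columnSum.comp (by fun_prop))).lowerSemicontinuous
  have h0K : (0 : Matrix (Fin r) ι ℂ) ∈ K := by
    intro a _ i _
    simpa using hR0
  obtain ⟨A, hAK, hA⟩ := LowerSemicontinuousOn.exists_isMinOn ⟨0, h0K⟩ hK
    (hlsc.lowerSemicontinuousOn K)
  refine ⟨A, fun A' => ?_⟩
  by_cases hA' : A' ∈ K
  · exact hA hA'
  · refine (hA h0K).trans ?_
    obtain ⟨a, i, hai⟩ : ∃ a i, R < ‖A' a i‖ := by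
      by_contra hcon
      push Not at hcon
      exact hA' fun a _ i _ => by simpa using hcon a i
    have h1 : ‖A' a i‖ ≤ ‖WithLp.toLp 2 (A'.col i)‖ :=
      PiLp.norm_apply_le (WithLp.toLp 2 (A'.col i)) a
    have h2 : ‖WithLp.toLp 2 (A'.col i)‖ = ‖WithLp.toLp 2 ((U * A').col i)‖ := by
      rw [toLp_col_mul, norm_toEuclideanLin_of_isometry hU]
    have h3 : WithLp.toLp 2 ((U * A').col i)
        = WithLp.toLp 2 (C.col i) - WithLp.toLp 2 ((C - U * A').col i) := by ext; simp
    have h4 := norm_sub_le (WithLp.toLp 2 (C.col i)) (WithLp.toLp 2 ((C - U * A').col i))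
    rw [← h3, ← h2] at h4
    have h5 := norm_col_le_columnSum C i
    have h6 := norm_col_le_columnSum (C - U * A') i
    have h7 : F 0 / lam < columnSum (C - U * A') := by linarith
    rw [div_lt_iff₀ hlam, mul_comm] at h7
    have h8 := nuclearNorm_nonneg (L + U * A' * B)
    change F 0 ≤ _
    linarith

/-- The admissible directions are `(U X B, -U X)`. A norming functional vanishing on all of them is
a pair `(N, Λ)`, and its vanishing is the identity `Uᴴ N Bᴴ = Uᴴ Λ`. -/
theorem exists_oracle_dual {t p r : ℕ} {ι : Type*} [Fintype ι]
    {U : Matrix (Fin t) (Fin r) ℂ} (hU : Uᴴ * U = 1) (L : Matrix (Fin t) (Fin p) ℂ)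
    (C : Matrix (Fin t) ι ℂ) (B : Matrix ι (Fin p) ℂ) {lam : ℝ} (hlam : 0 < lam) :
    ∃ (A : Matrix (Fin r) ι ℂ) (N : Matrix (Fin t) (Fin p) ℂ) (Λ : Matrix (Fin t) ι ℂ),
      IsContraction N ∧ (∀ i, ‖WithLp.toLp 2 (Λ.col i)‖ ≤ lam) ∧ Uᴴ * N * Bᴴ = Uᴴ * Λ ∧
      pairing N (L + U * A * B) = nuclearNorm (L + U * A * B) ∧
      pairing Λ (C - U * A) = lam * columnSum (C - U * A) := by
  classical
  obtain ⟨A, hA⟩ := exists_forall_nuclearNorm_add_columnSum_le hU L C B hlam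
  let Φ : Matrix (Fin r) ι ℂ →ₗ[ℝ] Matrix (Fin t) (Fin p) ℂ × Matrix (Fin t) ι ℂ :=
    { toFun := fun X => (U * X * B, -(U * X))
      map_add' := fun X Y => by simp [Matrix.mul_add, Matrix.add_mul, add_comm]
      map_smul' := fun c X => by simp }
  obtain ⟨g, hgN, hgS, hgx⟩ := exists_norming_functional (LinearMap.range Φ)
    (fun z : Matrix (Fin t) (Fin p) ℂ × Matrix (Fin t) ι ℂ =>
      nuclearNorm z.1 + lam * columnSum z.2)
    (fun c hc z => by
      simp only [Prod.smul_fst, Prod.smul_snd, nuclearNorm_smul _ hc, columnSum_smul _ hc]; ring)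
    (fun y z => by
      have h1 := nuclearNorm_add_le y.1 z.1
      have h2 := mul_le_mul_of_nonneg_left (columnSum_add_le y.2 z.2) hlam.le
      simp only [Prod.fst_add, Prod.snd_add]
      linarith)
    (fun z => add_nonneg (nuclearNorm_nonneg _) (mul_nonneg hlam.le (columnSum_nonneg _)))
    (L + U * A * B, C - U * A)
    (by
      rintro _ ⟨X, rfl⟩
      have := hA (A + X)
      simp only [Φ, LinearMap.coe_mk, AddHom.coe_mk, Prod.mk_add_mk]
      rw [Matrix.mul_add, Matrix.add_mul, ← add_assoc, ← sub_sub, sub_eq_add_neg (C - U * A)]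
        at this
      exact this)
  obtain ⟨N, hN⟩ := exists_pairing_eq (g.comp (LinearMap.inl ℝ _ _))
  obtain ⟨Λ, hΛ⟩ := exists_pairing_eq (g.comp (LinearMap.inr ℝ _ _))
  have hg : ∀ X Y, g (X, Y) = pairing N X + pairing Λ Y := by
    intro X Y
    rw [← hN, ← hΛ, LinearMap.comp_apply, LinearMap.comp_apply, ← map_add]
    simp
  have hz : nuclearNorm (0 : Matrix (Fin t) (Fin p) ℂ) = 0 := by simp [nuclearNorm]
  have hz' : columnSum (0 : Matrix (Fin t) ι ℂ) = 0 := by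
    have := columnSum_smul (0 : Matrix (Fin t) ι ℂ) (c := 2) two_pos
    rw [smul_zero] at this
    linarith
  have hNle : ∀ X, pairing N X ≤ nuclearNorm X := by
    intro X
    have := hgN (X, 0)
    simpa [hg, hz', pairing] using this
  have hΛle : ∀ Y, pairing Λ Y ≤ lam * columnSum Y := by
    intro Y
    have := hgN (0, Y)
    simpa [hg, hz, pairing] using this
  rw [hg] at hgx
  have h1 := hNle (L + U * A * B)
  have h2 := hΛle (C - U * A)
  simp only at hgx
  refine ⟨A, N, Λ, isContraction_of_pairing_le hNle, ?_, ?_, by linarith, by linarith⟩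
  · intro i
    refine norm_le_of_forall_re_inner_le hlam.le fun w => ?_
    have h3 := hΛle (Matrix.of fun a j => if j = i then w a else 0)
    have h4 : ∀ j, WithLp.toLp 2 ((Matrix.of fun a j => if j = i then w a else 0).col j)
        = if j = i then w else 0 := by
      intro j
      ext a
      by_cases hj : j = i <;> simp [hj]
    rw [pairing_eq_sum, columnSum] at h3
    simp only [h4] at h3
    rw [Finset.sum_eq_single i (by intro j _ hj; simp [hj]) (by simp),
      Finset.sum_eq_single i (by intro j _ hj; simp [hj]) (by simp)] at h3
    simpa using h3
  · rw [← sub_eq_zero]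
    refine eq_zero_of_pairing_eq_zero fun X => ?_
    have h3 := hgS (Φ X) ⟨X, rfl⟩
    simp only [Φ, LinearMap.coe_mk, AddHom.coe_mk] at h3
    rw [hg, ← zero_sub, pairing_sub_right, pairing_mul_right, pairing_mul_left, pairing_mul_left,
      ← Matrix.mul_assoc] at h3
    rw [pairing_sub_left]
    simpa [pairing, sub_eq_add_neg] using h3

end Duality

/-! ### Construction and size of the dual certificate, in operator form. -/

section Certificate

theorem re_inner_self {T : Type*} [NormedAddCommGroup T] [InnerProductSpace ℂ T] (v : T) : (inner ℂ v v).re = ‖v‖ ^ 2 := by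
  rw [inner_self_eq_norm_sq_to_K]; norm_cast

theorem re_inner_le {T : Type*} [NormedAddCommGroup T] [InnerProductSpace ℂ T] (v w : T) :
    (inner ℂ v w).re ≤ ‖v‖ * ‖w‖ :=
  re_inner_le_norm (𝕜 := ℂ) v w

variable {T R P K : Type*}
  [NormedAddCommGroup T] [InnerProductSpace ℂ T] [FiniteDimensional ℂ T]
  [NormedAddCommGroup R] [InnerProductSpace ℂ R] [FiniteDimensional ℂ R]
  [NormedAddCommGroup P] [InnerProductSpace ℂ P] [FiniteDimensional ℂ P]
  [NormedAddCommGroup K] [InnerProductSpace ℂ K]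

theorem norm_add_sq_of_adjoint_eq_zero {U : R →ₗ[ℂ] T} (hU : ∀ x, U.adjoint (U x) = x)
    (a : R) {b : T} (hb : U.adjoint b = 0) : ‖U a + b‖ ^ 2 = ‖a‖ ^ 2 + ‖b‖ ^ 2 := by
  have h1 : inner ℂ (U a) b = 0 := by rw [← LinearMap.adjoint_inner_right, hb, inner_zero_right]
  have h2 : ‖U a‖ ^ 2 = ‖a‖ ^ 2 := by
    rw [← re_inner_self, ← re_inner_self, ← LinearMap.adjoint_inner_right, hU]
  rw [@norm_add_sq ℂ, h1, h2]
  simp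

theorem norm_apply_eq_of_adjoint {U : R →ₗ[ℂ] T} (hU : ∀ x, U.adjoint (U x) = x)
    (a : R) : ‖U a‖ = ‖a‖ := by
  have h := norm_add_sq_of_adjoint_eq_zero hU a (b := 0) (by simp)
  simp only [add_zero, norm_zero, ne_eq, OfNat.ofNat_ne_zero, not_false_eq_true, zero_pow] at h
  exact (sq_eq_sq₀ (norm_nonneg _) (norm_nonneg _)).1 h

theorem norm_sq_eq_adjoint_add {U : R →ₗ[ℂ] T} (hU : ∀ x, U.adjoint (U x) = x) (v : T) :
    ‖v‖ ^ 2 = ‖U.adjoint v‖ ^ 2 + ‖v - U (U.adjoint v)‖ ^ 2 := by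
  rw [← norm_add_sq_of_adjoint_eq_zero hU (U.adjoint v)
    (b := v - U (U.adjoint v)) (by simp [hU])]
  simp

/-- Incoherence makes the row space perturbation by `Ω` injective. -/
theorem eq_zero_of_apply_eq_range {V : R →ₗ[ℂ] P} {Ω : K →ₗ[ℂ] P} {σ ρ : ℝ}
    (hV : ∀ x, V.adjoint (V x) = x)
    (hσ : ∀ x, ‖x‖ ^ 2 ≤ σ * ‖Ω x‖ ^ 2)
    (hρ : ∀ x, ‖V.adjoint (Ω x)‖ ≤ ρ * ‖x‖) (hρσ : ρ ^ 2 * σ < 1)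
    {a : R} {x : K} (h : V a = Ω x) : a = 0 := by
  have h1 : ‖a‖ ≤ ρ * ‖x‖ := by rw [← hV a, h]; exact hρ x
  have h2 : ‖a‖ ^ 2 ≤ ρ ^ 2 * σ * ‖a‖ ^ 2 := by
    calc ‖a‖ ^ 2 ≤ (ρ * ‖x‖) ^ 2 := by gcongr
      _ = ρ ^ 2 * ‖x‖ ^ 2 := by ring
      _ ≤ ρ ^ 2 * (σ * ‖Ω x‖ ^ 2) := by gcongr; exact hσ x
      _ = _ := by rw [← h, norm_apply_eq_of_adjoint hV]; ring
  have h3 : ‖a‖ ^ 2 = 0 := by nlinarith [sq_nonneg ‖a‖]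
  simpa using h3

variable [FiniteDimensional ℂ K]

/-- The dual certificate: a map extending `U Vt†` which takes the prescribed values `Λ` on the range
of `Ω` and is a strict contraction on the orthogonal complement of the range of `Vt`. -/
theorem exists_certificate {U : R →ₗ[ℂ] T} {Vt : R →ₗ[ℂ] P} {Λ : K →ₗ[ℂ] T} {Ω : K →ₗ[ℂ] P}
    {ψ : ℝ} (hψ0 : 0 ≤ ψ) (hψ1 : ψ < 1)
    (hU : ∀ x, U.adjoint (U x) = x) (hV : ∀ x, Vt.adjoint (Vt x) = x)
    (hΩV : ∀ x, Vt.adjoint (Ω x) = U.adjoint (Λ x))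
    (hΛ : ∀ x, ‖Λ x‖ ^ 2 ≤ ψ * ‖Ω x‖ ^ 2) (hΩ : ∀ x, Ω x = 0 → x = 0) :
    ∃ Q : P →ₗ[ℂ] T,
      (∀ v, U.adjoint (Q v) = Vt.adjoint v) ∧ (∀ x, Q (Vt x) = U x) ∧ (∀ x, Q (Ω x) = Λ x) ∧
      (∀ v, ‖Q v‖ ^ 2 ≤ ‖Vt.adjoint v‖ ^ 2 + ψ * ‖v - Vt (Vt.adjoint v)‖ ^ 2) ∧
      (∀ q, Ω.adjoint q = 0 → ∃ f x, ‖Q q‖ ^ 2 ≤ (inner ℂ f (Vt.adjoint q)).re ∧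
        Ω.adjoint (Vt f - Ω x) = 0 ∧ Vt.adjoint (Vt f - Ω x) = Vt.adjoint q) := by
  have hΩV' : ∀ x, Ω.adjoint (Vt x) = Λ.adjoint (U x) := by
    intro x
    refine ext_inner_left ℂ fun y => ?_
    rw [LinearMap.adjoint_inner_right, LinearMap.adjoint_inner_right,
      ← LinearMap.adjoint_inner_left, ← LinearMap.adjoint_inner_left, hΩV]
  -- By the compatibility of `Λ` and `Ω`, this is `Ω* (1 - Vt Vt*) Ω`, the Gram operator of the part
  -- of `Ω` orthogonal to the range of `Vt`. A kernel vector would satisfy `‖Ω x‖ = ‖U* Λ x‖ ≤ ‖Λ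
  -- x‖`, which `ψ < 1` allows only for `Ω x = 0`.
  let S : K →ₗ[ℂ] K := Ω.adjoint ∘ₗ Ω - (Λ.adjoint ∘ₗ U) ∘ₗ (U.adjoint ∘ₗ Λ)
  have hS : ∀ x, S x = Ω.adjoint (Ω x) - Λ.adjoint (U (U.adjoint (Λ x))) := fun x => rfl
  have hSq : ∀ x, (inner ℂ x (S x)).re = ‖Ω x‖ ^ 2 - ‖U.adjoint (Λ x)‖ ^ 2 := by
    intro x
    rw [hS, inner_sub_right, LinearMap.adjoint_inner_right, LinearMap.adjoint_inner_right,
      ← LinearMap.adjoint_inner_left U, Complex.sub_re, re_inner_self, re_inner_self]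
  have hE : ∀ x, ‖Λ x - U (U.adjoint (Λ x))‖ ^ 2 = ‖Λ x‖ ^ 2 - ‖U.adjoint (Λ x)‖ ^ 2 := by
    intro x
    have := norm_sq_eq_adjoint_add hU (Λ x)
    linarith
  have hSinj : Function.Injective S := by
    rw [injective_iff_map_eq_zero]
    intro x hx
    have h1 := hSq x
    rw [hx, inner_zero_right, Complex.zero_re] at h1
    have h2 := hE x
    have h3 := sq_nonneg ‖Λ x - U (U.adjoint (Λ x))‖
    have h4 := hΛ x
    have h5 : ‖Ω x‖ ^ 2 = 0 := by nlinarith [sq_nonneg ‖Ω x‖]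
    exact hΩ x (by simpa using h5)
  let e : K ≃ₗ[ℂ] K := LinearEquiv.ofInjectiveEndo S hSinj
  have he : ∀ x, S (e.symm x) = x := fun x => e.apply_symm_apply x
  have he' : ∀ x, e.symm (S x) = x := fun x => e.symm_apply_apply x
  let E : K →ₗ[ℂ] T := Λ - U ∘ₗ U.adjoint ∘ₗ Λ
  have hEapp : ∀ x, E x = Λ x - U (U.adjoint (Λ x)) := fun x => rfl
  -- The second term sees only the component orthogonal to `Vt`, takes values orthogonal to `U`, and
  -- supplies the part `E` of `Λ` that `U Vt*` misses on the range of `Ω`.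
  let Q : P →ₗ[ℂ] T := U ∘ₗ Vt.adjoint +
    E ∘ₗ e.symm.toLinearMap ∘ₗ Ω.adjoint ∘ₗ (LinearMap.id - Vt ∘ₗ Vt.adjoint)
  have hQ : ∀ v, Q v = U (Vt.adjoint v) + E (e.symm (Ω.adjoint (v - Vt (Vt.adjoint v)))) :=
    fun v => rfl
  have hUE : ∀ x, U.adjoint (E x) = 0 := by
    intro x
    rw [hEapp, map_sub, hU, sub_self]
  have hQn : ∀ v, ‖Q v‖ ^ 2 = ‖Vt.adjoint v‖ ^ 2 +
      ‖E (e.symm (Ω.adjoint (v - Vt (Vt.adjoint v))))‖ ^ 2 := by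
    intro v
    rw [hQ, norm_add_sq_of_adjoint_eq_zero hU _ (hUE _)]
  refine ⟨Q, ?_, ?_, ?_, ?_, ?_⟩
  · intro v
    rw [hQ, map_add, hUE, hU, add_zero]
  · intro x
    simp [hQ, hV]
  · intro x
    have h1 : Ω.adjoint (Ω x - Vt (Vt.adjoint (Ω x))) = S x := by
      rw [map_sub, hΩV', hΩV, hS]
    rw [hQ, h1, he', hΩV, hEapp]
    abel
  · intro v
    rw [hQn]
    set q := v - Vt (Vt.adjoint v) with hq
    set x := e.symm (Ω.adjoint q) with hx
    have hSx : S x = Ω.adjoint q := he _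
    have hVq : Vt.adjoint q = 0 := by rw [hq, map_sub, hV, sub_self]
    have h1 : ‖E x‖ ^ 2 ≤ ψ * (‖Ω x‖ ^ 2 - ‖U.adjoint (Λ x)‖ ^ 2) := by
      rw [hEapp, hE]
      nlinarith [hΛ x, sq_nonneg ‖U.adjoint (Λ x)‖]
    have h2 := norm_sq_eq_adjoint_add hV (Ω x)
    rw [hΩV] at h2
    have h3 : (inner ℂ (Ω x - Vt (U.adjoint (Λ x))) q).re
        = ‖Ω x‖ ^ 2 - ‖U.adjoint (Λ x)‖ ^ 2 := by
      rw [← hSq, hSx, inner_sub_left, ← LinearMap.adjoint_inner_right Vt, hVq, inner_zero_right,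
        sub_zero, ← LinearMap.adjoint_inner_right]
    have h4 := re_inner_le (Ω x - Vt (U.adjoint (Λ x))) q
    -- The left side is the squared norm of `Ω x - Vt (U* Λ x)`, which is also its inner product
    -- with `q`; Cauchy–Schwarz concludes.
    have h5 : ‖Ω x‖ ^ 2 - ‖U.adjoint (Λ x)‖ ^ 2 ≤ ‖q‖ ^ 2 := by
      nlinarith [sq_nonneg (‖Ω x - Vt (U.adjoint (Λ x))‖ - ‖q‖)]
    nlinarith [mul_le_mul_of_nonneg_left h5 hψ0]
  · intro q hq
    set y := Vt.adjoint q with hy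
    set x := - e.symm (Ω.adjoint (q - Vt y)) with hx
    have hSx : S x = Λ.adjoint (U y) := by
      rw [hx, map_neg, he, map_sub, hq, zero_sub, neg_neg, hΩV']
    -- With this choice `Vt f - Ω x` is the orthogonal projection of `q` onto `range Vt + range Ω`,
    -- and the inner product in the bound is its squared norm.
    refine ⟨y + U.adjoint (Λ x), x, ?_, ?_, ?_⟩
    · have h0 : ‖Q q‖ ^ 2 = ‖y‖ ^ 2 + ‖E x‖ ^ 2 := by
        rw [hQn, hx, map_neg, norm_neg]
      rw [h0, hEapp, hE]
      have h1 : ‖Ω x‖ ^ 2 - ‖U.adjoint (Λ x)‖ ^ 2 = (inner ℂ (U.adjoint (Λ x)) y).re := by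
        rw [← hSq, hSx, LinearMap.adjoint_inner_right, LinearMap.adjoint_inner_left]
      rw [inner_add_left, Complex.add_re, re_inner_self]
      nlinarith [hΛ x, sq_nonneg ‖Ω x‖]
    · have h1 : Ω.adjoint (Ω x) = Λ.adjoint (U y) + Λ.adjoint (U (U.adjoint (Λ x))) := by
        rw [← hSx, hS]; abel
      rw [map_sub, hΩV', h1, map_add, map_add, sub_self]
    · rw [map_sub, hV, hΩV, add_sub_cancel_right]

/-- The value at `q` of the certificate is controlled by the incoherence between `V` and `Ω`. -/
theorem norm_sq_le_of_orthogonal {Vt V : R →ₗ[ℂ] P} {Ω : K →ₗ[ℂ] P} {σ ρ : ℝ}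
    (hV : ∀ x, V.adjoint (V x) = x)
    (hσ : ∀ x, ‖x‖ ^ 2 ≤ σ * ‖Ω x‖ ^ 2) (hσ0 : 0 ≤ σ)
    (hρ : ∀ x, ‖V.adjoint (Ω x)‖ ≤ ρ * ‖x‖)
    (hrange : ∀ f, ∃ a x, Vt f = V a + Ω x) {q : P} (hq : Ω.adjoint q = 0) {f : R} {x : K}
    (h1 : Ω.adjoint (Vt f - Ω x) = 0) (h2 : Vt.adjoint (Vt f - Ω x) = Vt.adjoint q) :
    (1 - ρ ^ 2 * σ) * (inner ℂ f (Vt.adjoint q)).re ≤ ‖V.adjoint q‖ ^ 2 := by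
  obtain ⟨a, b, hab⟩ := hrange f
  set h := Vt f - Ω x with hh
  have hh' : h = V a + Ω (b - x) := by rw [hh, hab, map_sub]; abel
  have e1 : (inner ℂ f (Vt.adjoint q)).re = ‖h‖ ^ 2 := by
    rw [← h2, LinearMap.adjoint_inner_right, ← re_inner_self]
    have : Vt f = h + Ω x := by rw [hh]; abel
    rw [this, inner_add_left, ← LinearMap.adjoint_inner_right Ω, h1, inner_zero_right, add_zero]
  have e2 : (inner ℂ f (Vt.adjoint q)).re = (inner ℂ a (V.adjoint q)).re := by
    rw [LinearMap.adjoint_inner_right, hab, inner_add_left, ← LinearMap.adjoint_inner_right Ω, hq,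
      inner_zero_right, add_zero, LinearMap.adjoint_inner_right]
  set c := b - x with hc
  have hVa : V a = h + Ω (-c) := by rw [hh', map_neg]; abel
  have e3 : ‖a‖ ^ 2 = ‖h‖ ^ 2 + ‖Ω c‖ ^ 2 := by
    rw [← norm_apply_eq_of_adjoint hV, hVa, @norm_add_sq ℂ, ← LinearMap.adjoint_inner_left, h1]
    simp
  have e4 : ‖Ω c‖ ^ 2 = -(inner ℂ a (V.adjoint (Ω c))).re := by
    rw [LinearMap.adjoint_inner_right, hVa, inner_add_left, ← LinearMap.adjoint_inner_left, h1,
      inner_zero_left, zero_add, map_neg, inner_neg_left, Complex.neg_re, neg_neg, re_inner_self]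
  have e5 : ‖Ω c‖ ^ 2 ≤ ‖a‖ * (ρ * ‖c‖) := by
    have := re_inner_le (-a) (V.adjoint (Ω c))
    rw [inner_neg_left, Complex.neg_re, ← e4, norm_neg] at this
    exact this.trans (mul_le_mul_of_nonneg_left (hρ c) (norm_nonneg a))
  -- Together with the Pythagorean identity `e3` this gives `(1 - ρ² σ) ‖a‖² ≤ ‖h‖²`. Since `‖h‖² ≤
  -- ‖a‖ ‖V* q‖`, the coefficient `a` can be eliminated.
  have e6 : ‖Ω c‖ ^ 2 ≤ ρ ^ 2 * σ * ‖a‖ ^ 2 := by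
    have h4 : (‖Ω c‖ ^ 2) ^ 2 ≤ ‖a‖ ^ 2 * ρ ^ 2 * (σ * ‖Ω c‖ ^ 2) := by
      calc (‖Ω c‖ ^ 2) ^ 2 ≤ (‖a‖ * (ρ * ‖c‖)) ^ 2 := by gcongr
        _ = ‖a‖ ^ 2 * ρ ^ 2 * ‖c‖ ^ 2 := by ring
        _ ≤ _ := by gcongr; exact hσ c
    rcases (sq_nonneg ‖Ω c‖).eq_or_lt with h0 | h0
    · rw [← h0]; positivity
    · nlinarith
  have e7 : (inner ℂ f (Vt.adjoint q)).re ≤ ‖a‖ * ‖V.adjoint q‖ := e2 ▸ re_inner_le _ _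
  rw [e1] at e7 ⊢
  rcases le_or_gt (1 - ρ ^ 2 * σ) 0 with hneg | hpos
  · exact (mul_nonpos_of_nonpos_of_nonneg hneg (sq_nonneg _)).trans (sq_nonneg _)
  rcases (sq_nonneg ‖h‖).eq_or_lt with h0 | h0
  · rw [← h0]; simp
  · have h4 : (1 - ρ ^ 2 * σ) * (‖h‖ ^ 2) ^ 2 ≤ ‖h‖ ^ 2 * ‖V.adjoint q‖ ^ 2 := by
      calc (1 - ρ ^ 2 * σ) * (‖h‖ ^ 2) ^ 2 ≤ (1 - ρ ^ 2 * σ) * (‖a‖ * ‖V.adjoint q‖) ^ 2 := by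
            gcongr
        _ = ((1 - ρ ^ 2 * σ) * ‖a‖ ^ 2) * ‖V.adjoint q‖ ^ 2 := by ring
        _ ≤ _ := by
            gcongr
            nlinarith
    nlinarith

theorem exists_add_of_injective {Ω : K →ₗ[ℂ] P} {σ : ℝ} (hσ0 : 0 ≤ σ)
    (hσ : ∀ x, ‖x‖ ^ 2 ≤ σ * ‖Ω x‖ ^ 2) (w : P) :
    ∃ b q, w = Ω b + q ∧ Ω.adjoint q = 0 ∧ ‖b‖ ≤ σ * ‖Ω.adjoint w‖ := by
  obtain ⟨y, hy, z, hz, rfl⟩ := (LinearMap.range Ω).exists_add_mem_mem_orthogonal w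
  obtain ⟨b, rfl⟩ := hy
  have hz' : Ω.adjoint z = 0 := by
    refine ext_inner_left ℂ fun v => ?_
    rw [LinearMap.adjoint_inner_right, inner_zero_right]
    exact hz _ ⟨v, rfl⟩
  refine ⟨b, z, rfl, hz', ?_⟩
  rw [map_add, hz', add_zero]
  have h1 : ‖Ω b‖ ^ 2 ≤ ‖b‖ * ‖Ω.adjoint (Ω b)‖ := by
    rw [← re_inner_self, ← LinearMap.adjoint_inner_right]
    exact re_inner_le _ _
  have h2 : ‖b‖ ^ 2 ≤ σ * (‖b‖ * ‖Ω.adjoint (Ω b)‖) :=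
    (hσ b).trans (mul_le_mul_of_nonneg_left h1 hσ0)
  rcases (norm_nonneg b).eq_or_lt with h0 | h0
  · rw [← h0]; positivity
  · nlinarith

end Certificate

/-! ### Gram matrices, coherence and the constant `σ_k`. -/

section Coherence

theorem norm_toEuclideanLin_sq_le {m ι : Type*} [Fintype m] [Fintype ι] [DecidableEq ι]
    {A : Matrix m ι ℂ} {c : ℝ} (hA : ∀ i, ‖WithLp.toLp 2 (A.col i)‖ ≤ c) {k : ℕ}
    (hk : Fintype.card ι ≤ k) (x : EuclideanSpace ℂ ι) :
    ‖A.toEuclideanLin x‖ ^ 2 ≤ c ^ 2 * k * ‖x‖ ^ 2 := by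
  have h1 : A.toEuclideanLin x = ∑ i, x i • WithLp.toLp 2 (A.col i) := by
    ext a
    simp [Matrix.mulVec, dotProduct, mul_comm]
  have h2 : ‖A.toEuclideanLin x‖ ≤ ∑ i, c * ‖x i‖ := by
    rw [h1]
    refine (norm_sum_le _ _).trans (Finset.sum_le_sum fun i _ => ?_)
    rw [norm_smul, mul_comm]
    exact mul_le_mul_of_nonneg_right (hA i) (norm_nonneg _)
  have h3 : (∑ i, ‖x i‖) ^ 2 ≤ Fintype.card ι * ∑ i, ‖x i‖ ^ 2 := by
    simpa using sq_sum_le_card_mul_sum_sq (s := Finset.univ) (f := fun i => ‖x i‖)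
  rw [← Finset.mul_sum] at h2
  rw [EuclideanSpace.norm_sq_eq x]
  calc ‖A.toEuclideanLin x‖ ^ 2 ≤ (c * ∑ i, ‖x i‖) ^ 2 := by gcongr
    _ = c ^ 2 * (∑ i, ‖x i‖) ^ 2 := by ring
    _ ≤ c ^ 2 * (Fintype.card ι * ∑ i, ‖x i‖ ^ 2) := by gcongr
    _ ≤ c ^ 2 * (k * ∑ i, ‖x i‖ ^ 2) := by gcongr
    _ = _ := by ring

theorem norm_toEuclideanLin_le {m ι : Type*} [Fintype m] [Fintype ι] [DecidableEq ι]
    {A : Matrix m ι ℂ} {c : ℝ} (hc : 0 ≤ c) (hA : ∀ i, ‖WithLp.toLp 2 (A.col i)‖ ≤ c) {k : ℕ}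
    (hk : Fintype.card ι ≤ k) (x : EuclideanSpace ℂ ι) :
    ‖A.toEuclideanLin x‖ ≤ c * √k * ‖x‖ := by
  refine (sq_le_sq₀ (norm_nonneg _) (by positivity)).1 ?_
  rw [mul_pow, mul_pow, Real.sq_sqrt (Nat.cast_nonneg k)]
  exact norm_toEuclideanLin_sq_le hA hk x

theorem norm_le_sqrt_mul_of_forall_norm_le {ι : Type*} [Fintype ι] {v : EuclideanSpace ℂ ι}
    {c : ℝ} (hc : 0 ≤ c) (hv : ∀ i, ‖v i‖ ≤ c) {k : ℕ} (hk : Fintype.card ι ≤ k) :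
    ‖v‖ ≤ √k * c := by
  refine (sq_le_sq₀ (norm_nonneg _) (by positivity)).1 ?_
  rw [mul_pow, Real.sq_sqrt (Nat.cast_nonneg k), EuclideanSpace.norm_sq_eq]
  calc ∑ i, ‖v i‖ ^ 2 ≤ ∑ _i : ι, c ^ 2 := by
        gcongr with i
        exact hv i
    _ = Fintype.card ι * c ^ 2 := by simp
    _ ≤ _ := by gcongr

variable {p n : ℕ} {W : Matrix (Fin p) (Fin n) ℂ}

theorem coherence_nonneg (W : Matrix (Fin p) (Fin n) ℂ) : 0 ≤ coherence W :=
  Real.iSup_nonneg fun _ => norm_nonneg _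

theorem norm_gram_le_coherence (W : Matrix (Fin p) (Fin n) ℂ) {i j : Fin n} (hij : i ≠ j) :
    ‖(Wᴴ * W) i j‖ ≤ coherence W :=
  le_ciSup (f := fun q : {q : Fin n × Fin n // q.1 ≠ q.2} => ‖(Wᴴ * W) q.1.1 q.1.2‖)
    (Set.finite_range _).bddAbove ⟨(i, j), hij⟩

theorem gram_apply_self (hW : ∀ j, colNorm W j = 1) (j : Fin n) : (Wᴴ * W) j j = 1 := by
  have h1 : (Wᴴ * W) j j = inner ℂ (WithLp.toLp 2 (W.col j)) (WithLp.toLp 2 (W.col j)) := by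
    rw [PiLp.inner_apply, Matrix.mul_apply]
    exact Finset.sum_congr rfl fun a _ => mul_comm _ _
  have h2 : ‖WithLp.toLp 2 (W.col j)‖ = 1 := hW j
  rw [h1, inner_self_eq_norm_sq_to_K, h2]
  simp

theorem sigma_nonneg (W : Matrix (Fin p) (Fin n) ℂ) (k : ℕ) : 0 ≤ sigma W k :=
  Real.iSup_nonneg fun _ => norm_nonneg _

theorem norm_inv_gram_le_sigma (W : Matrix (Fin p) (Fin n) ℂ) {k : ℕ} {I : Finset (Fin n)}
    (hI : I.card ≤ k) :
    ‖Matrix.toEuclideanCLM (𝕜 := ℂ) ((columns W I)ᴴ * columns W I)⁻¹‖ ≤ sigma W k :=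
  le_ciSup (f := fun I : {I : Finset (Fin n) // I.card ≤ k} =>
      ‖Matrix.toEuclideanCLM (𝕜 := ℂ) ((columns W I.1)ᴴ * columns W I.1)⁻¹‖)
    (Set.finite_range _).bddAbove ⟨I, hI⟩

/-- The Gram matrix is strictly diagonally dominant. Invertibility matters because the inverse of a
singular matrix is `0` by convention, and `sigma` would then carry no information. -/
theorem isUnit_det_gram (hW : ∀ j, colNorm W j = 1) {k : ℕ} (hk : k * coherence W < 1)
    {I : Finset (Fin n)} (hI : I.card ≤ k) : IsUnit ((columns W I)ᴴ * columns W I).det := by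
  refine isUnit_iff_ne_zero.2 (det_ne_zero_of_sum_row_lt_diag fun i => ?_)
  have h1 : ∀ i j, ((columns W I)ᴴ * columns W I) i j = (Wᴴ * W) i j := fun i j => rfl
  simp only [h1, gram_apply_self hW, norm_one]
  calc ∑ j ∈ Finset.univ.erase i, ‖(Wᴴ * W) i j‖
      ≤ ∑ _j ∈ Finset.univ.erase i, coherence W := by
        refine Finset.sum_le_sum fun j hj => norm_gram_le_coherence W fun h => ?_
        exact Finset.ne_of_mem_erase hj (Subtype.ext h.symm)
    _ ≤ k * coherence W := by
        rw [Finset.sum_const, nsmul_eq_mul]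
        refine mul_le_mul_of_nonneg_right ?_ (coherence_nonneg W)
        have : (Finset.univ.erase i).card ≤ I.card := by simp
        exact_mod_cast this.trans hI
    _ < 1 := hk

/-- With `z` the inverse Gram matrix applied to `x`, one has `‖x‖² = Re ⟨A x, A z⟩` and `‖A z‖² = Re
⟨z, x⟩ ≤ σ ‖x‖²`; Cauchy–Schwarz combines the two. -/
theorem norm_sq_le_sigma_mul (hW : ∀ j, colNorm W j = 1) {k : ℕ} (hk : k * coherence W < 1)
    {I : Finset (Fin n)} (hI : I.card ≤ k) (x : EuclideanSpace ℂ I) :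
    ‖x‖ ^ 2 ≤ sigma W k * ‖(columns W I).toEuclideanLin x‖ ^ 2 := by
  set A := columns W I with hA
  set z := (Aᴴ * A)⁻¹.toEuclideanLin x with hz
  have hx : x = Aᴴ.toEuclideanLin (A.toEuclideanLin z) := by
    rw [← toEuclideanLin_mul_apply, hz, ← toEuclideanLin_mul_apply,
      Matrix.mul_nonsing_inv _ (isUnit_det_gram hW hk hI), Matrix.toLpLin_one]
    rfl
  have hzn : ‖z‖ ≤ sigma W k * ‖x‖ := by
    have h1 : z = Matrix.toEuclideanCLM (𝕜 := ℂ) (Aᴴ * A)⁻¹ x := by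
      rw [hz, ← Matrix.coe_toEuclideanCLM_eq_toEuclideanLin]; rfl
    rw [h1]
    exact (ContinuousLinearMap.le_opNorm _ _).trans
      (mul_le_mul_of_nonneg_right (norm_inv_gram_le_sigma W hI) (norm_nonneg x))
  have h1 : ‖A.toEuclideanLin z‖ ^ 2 ≤ sigma W k * ‖x‖ ^ 2 := by
    have h2 : (inner ℂ z x).re = ‖A.toEuclideanLin z‖ ^ 2 := by
      conv_lhs => rw [hx]
      rw [← inner_toEuclideanLin_left, re_inner_self]
    rw [← h2]
    refine (re_inner_le z x).trans ?_
    nlinarith [norm_nonneg x]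
  have h2 : ‖x‖ ^ 2 ≤ ‖A.toEuclideanLin x‖ * ‖A.toEuclideanLin z‖ := by
    have h3 : (inner ℂ x x).re = (inner ℂ (A.toEuclideanLin x) (A.toEuclideanLin z)).re := by
      conv_lhs => rw [hx]
      rw [← inner_toEuclideanLin_left, ← hx]
    rw [← re_inner_self, h3]
    exact re_inner_le _ _
  rcases (sq_nonneg ‖x‖).eq_or_lt with h0 | h0
  · rw [← h0]
    exact mul_nonneg (sigma_nonneg W k) (sq_nonneg _)
  · have h3 : (‖x‖ ^ 2) ^ 2 ≤ ‖A.toEuclideanLin x‖ ^ 2 * (sigma W k * ‖x‖ ^ 2) := by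
      calc (‖x‖ ^ 2) ^ 2 ≤ (‖A.toEuclideanLin x‖ * ‖A.toEuclideanLin z‖) ^ 2 := by gcongr
        _ = ‖A.toEuclideanLin x‖ ^ 2 * ‖A.toEuclideanLin z‖ ^ 2 := by ring
        _ ≤ _ := by gcongr
    nlinarith

theorem norm_toEuclideanLin_map_star {m ι : Type*} [Fintype m] [Fintype ι] [DecidableEq ι]
    (A : Matrix m ι ℂ) (x : EuclideanSpace ℂ ι) :
    ‖(A.map star).toEuclideanLin x‖ = ‖A.toEuclideanLin (WithLp.toLp 2 (star x.ofLp))‖ := by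
  have h : ∀ a, (A.map star).toEuclideanLin x a =
      star (A.toEuclideanLin (WithLp.toLp 2 (star x.ofLp)) a) := by
    intro a
    simp [Matrix.mulVec, dotProduct]
  rw [EuclideanSpace.norm_eq, EuclideanSpace.norm_eq]
  simp only [h, norm_star]

theorem norm_sq_le_sigma_mul_map_star (hW : ∀ j, colNorm W j = 1) {k : ℕ}
    (hk : k * coherence W < 1) {I : Finset (Fin n)} (hI : I.card ≤ k) (x : EuclideanSpace ℂ I) :
    ‖x‖ ^ 2 ≤ sigma W k * ‖((columns W I).map star).toEuclideanLin x‖ ^ 2 := by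
  rw [norm_toEuclideanLin_map_star]
  have h : ‖x‖ = ‖(WithLp.toLp 2 (star x.ofLp) : EuclideanSpace ℂ I)‖ := by
    rw [EuclideanSpace.norm_eq, EuclideanSpace.norm_eq]
    simp
  rw [h]
  exact norm_sq_le_sigma_mul hW hk hI _

theorem eps_nonneg {r : ℕ} (V : Matrix (Fin p) (Fin r) ℂ) (W : Matrix (Fin p) (Fin n) ℂ) :
    0 ≤ eps V W :=
  Real.iSup_nonneg fun _ => norm_nonneg _

theorem norm_col_le_eps {r : ℕ} (V : Matrix (Fin p) (Fin r) ℂ) (W : Matrix (Fin p) (Fin n) ℂ)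
    (j : Fin n) : ‖Vᴴ.toEuclideanLin (WithLp.toLp 2 ((W.map star).col j))‖ ≤ eps V W := by
  rw [← toLp_col_mul]
  exact le_ciSup (f := fun j => colNorm (Vᴴ * W.map star) j) (Set.finite_range _).bddAbove j

theorem norm_gram_col_le (W : Matrix (Fin p) (Fin n) ℂ) {k : ℕ} {I : Finset (Fin n)}
    (hI : I.card ≤ k) {j : Fin n} (hj : j ∉ I) :
    ‖((columns W I).map star)ᴴ.toEuclideanLin (WithLp.toLp 2 ((W.map star).col j))‖ ≤
      √k * coherence W := by
  refine norm_le_sqrt_mul_of_forall_norm_le (coherence_nonneg W) (fun i => ?_) (by simpa using hI)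
  have hij : (i : Fin n) ≠ j := fun h => hj (h ▸ i.2)
  refine le_trans (le_of_eq ?_) (norm_gram_le_coherence W hij)
  rw [← norm_star ((Wᴴ * W) i j)]
  congr 1
  simp [Matrix.mulVec, dotProduct, Matrix.mul_apply, columns]

end Coherence

/-! ### Preservation of the column space and the certificate in matrix form. -/

section Rank

theorem ext_toEuclideanLin {m n : Type*} [Fintype n] [DecidableEq n] {A B : Matrix m n ℂ}
    (h : ∀ x, A.toEuclideanLin x = B.toEuclideanLin x) : A = B :=
  Matrix.toEuclideanLin.injective (LinearMap.ext h)

theorem IsContraction.conjTranspose {m n : Type*} [Fintype m] [Fintype n] [DecidableEq n]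
    [DecidableEq m] {N : Matrix m n ℂ} (hN : IsContraction N) : IsContraction Nᴴ := by
  intro x
  have h1 : ‖Nᴴ.toEuclideanLin x‖ ^ 2 =
      (inner ℂ x (N.toEuclideanLin (Nᴴ.toEuclideanLin x))).re := by
    rw [← re_inner_self, inner_toEuclideanLin_left, conjTranspose_conjTranspose]
  have h2 := (re_inner_le x (N.toEuclideanLin (Nᴴ.toEuclideanLin x))).trans
    (mul_le_mul_of_nonneg_left (hN _) (norm_nonneg x))
  rw [← h1] at h2
  by_contra hlt
  nlinarith [norm_nonneg x, norm_nonneg (Nᴴ.toEuclideanLin x)]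

theorem IsSVD.conjTranspose {m n r : ℕ} {A : Matrix (Fin m) (Fin n) ℂ}
    {U : Matrix (Fin m) (Fin r) ℂ} {s : Fin r → ℝ} {V : Matrix (Fin n) (Fin r) ℂ}
    (h : IsSVD A U s V) : IsSVD Aᴴ V s U := by
  refine ⟨h.right_orthonormal, h.left_orthonormal, h.pos, ?_⟩
  rw [h.eq, conjTranspose_mul, conjTranspose_mul, conjTranspose_conjTranspose,
    diagonal_conjTranspose, Matrix.mul_assoc]
  congr 3
  ext i
  simp

theorem pairing_conjTranspose {m n : Type*} [Fintype m] [Fintype n] (Q A : Matrix m n ℂ) :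
    pairing Qᴴ Aᴴ = pairing Q A := by
  unfold pairing
  rw [← conjTranspose_mul, trace_conjTranspose, trace_mul_comm]
  simp

theorem IsSVD.left_mul_self {m n r : ℕ} {A : Matrix (Fin m) (Fin n) ℂ}
    {U : Matrix (Fin m) (Fin r) ℂ} {s : Fin r → ℝ} {V : Matrix (Fin n) (Fin r) ℂ}
    (h : IsSVD A U s V) : U * Uᴴ * A = A := by
  conv_rhs => rw [h.eq]
  rw [h.eq, Matrix.mul_assoc U Uᴴ, Matrix.mul_assoc U _ Vᴴ, ← Matrix.mul_assoc Uᴴ,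
    h.left_orthonormal, Matrix.one_mul]

theorem IsSVD.left_eq_mul {m n r : ℕ} {A : Matrix (Fin m) (Fin n) ℂ}
    {U : Matrix (Fin m) (Fin r) ℂ} {s : Fin r → ℝ} {V : Matrix (Fin n) (Fin r) ℂ}
    (h : IsSVD A U s V) : ∃ X : Matrix (Fin n) (Fin r) ℂ, U = A * X := by
  refine ⟨V * diagonal fun i => (s i : ℂ)⁻¹, ?_⟩
  have h1 : (diagonal fun i => (s i : ℂ)) * (diagonal fun i => (s i : ℂ)⁻¹) = 1 := by
    rw [diagonal_mul_diagonal, ← diagonal_one]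
    congr 1
    ext i
    have : (s i : ℂ) ≠ 0 := by exact_mod_cast (h.pos i).ne'
    exact mul_inv_cancel₀ this
  rw [h.eq, ← Matrix.mul_assoc, Matrix.mul_assoc _ Vᴴ, h.right_orthonormal, Matrix.mul_one,
    Matrix.mul_assoc, h1, Matrix.mul_one]

open scoped ComplexOrder in
-- The part `Y` of `U` orthogonal to the columns of `L` satisfies `Lᴴ U (Uᴴ Y) = Lᴴ Y = 0`.
-- Injectivity gives `Uᴴ Y = 0`, and then `Yᴴ Y = 0`.
theorem IsSVD.mul_conjTranspose_mul_of_injective {m n r r' : ℕ} {L : Matrix (Fin m) (Fin n) ℂ}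
    {U : Matrix (Fin m) (Fin r) ℂ}
    (hUL : U * Uᴴ * L = L) (hinj : ∀ X : Matrix (Fin r) (Fin r) ℂ, Lᴴ * U * X = 0 → X = 0)
    {U₁ : Matrix (Fin m) (Fin r') ℂ} {s₁ : Fin r' → ℝ} {V₁ : Matrix (Fin n) (Fin r') ℂ}
    (h : IsSVD L U₁ s₁ V₁) : U₁ * U₁ᴴ * U = U := by
  have hL1 := h.left_mul_self
  have hL1' : Lᴴ * (U₁ * U₁ᴴ) = Lᴴ := by
    have := congrArg Matrix.conjTranspose hL1
    simpa using this
  have hUL' : Lᴴ * (U * Uᴴ) = Lᴴ := by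
    have := congrArg Matrix.conjTranspose hUL
    simpa using this
  set Y := U - U₁ * U₁ᴴ * U with hY
  have h1 : Uᴴ * Y = 0 := by
    refine hinj _ ?_
    calc Lᴴ * U * (Uᴴ * Y) = Lᴴ * (U * Uᴴ) * Y := by simp only [Matrix.mul_assoc]
      _ = Lᴴ * U - Lᴴ * (U₁ * U₁ᴴ) * U := by
        rw [hUL', hY, Matrix.mul_sub]; simp only [Matrix.mul_assoc]
      _ = 0 := by rw [hL1', sub_self]
  have h2 : U₁ᴴ * Y = 0 := by
    rw [hY, Matrix.mul_sub, ← Matrix.mul_assoc, ← Matrix.mul_assoc, h.left_orthonormal,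
      Matrix.one_mul, sub_self]
  have h3 : Yᴴ * Y = 0 := by
    conv_lhs => rw [hY]
    rw [← hY, conjTranspose_sub, Matrix.sub_mul, h1, conjTranspose_mul, conjTranspose_mul,
      conjTranspose_conjTranspose, Matrix.mul_assoc, Matrix.mul_assoc, h2]
    simp
  rw [Matrix.conjTranspose_mul_self_eq_zero, hY, sub_eq_zero] at h3
  exact h3.symm

theorem IsSVD.mul_conjTranspose_mul_left {m n r r' : ℕ} {L : Matrix (Fin m) (Fin n) ℂ}
    {U : Matrix (Fin m) (Fin r) ℂ} (hUL : U * Uᴴ * L = L)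
    {U₁ : Matrix (Fin m) (Fin r') ℂ} {s₁ : Fin r' → ℝ} {V₁ : Matrix (Fin n) (Fin r') ℂ}
    (h : IsSVD L U₁ s₁ V₁) : U * Uᴴ * U₁ = U₁ := by
  obtain ⟨X, hX⟩ := h.left_eq_mul
  rw [hX, ← Matrix.mul_assoc, hUL]

theorem IsSVD.conjTranspose_add_mul {t p r : ℕ} {ι : Type*} [Fintype ι]
    {L : Matrix (Fin t) (Fin p) ℂ} {U : Matrix (Fin t) (Fin r) ℂ}
    {s : Fin r → ℝ} {V : Matrix (Fin p) (Fin r) ℂ} (h : IsSVD L U s V)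
    (A : Matrix (Fin r) ι ℂ) (Ω : Matrix (Fin p) ι ℂ) :
    (L + U * A * Ωᴴ)ᴴ = (V * diagonal (fun i => (s i : ℂ)) + Ω * Aᴴ) * Uᴴ := by
  rw [conjTranspose_add, h.conjTranspose.eq, Matrix.add_mul, conjTranspose_mul, conjTranspose_mul,
    conjTranspose_conjTranspose]
  simp only [Matrix.mul_assoc]

variable {t p r : ℕ} {ι : Type*} [Fintype ι] [DecidableEq ι]

theorem adjoint_toEuclideanLin {m n : Type*} [Fintype m] [Fintype n] [DecidableEq n]
    [DecidableEq m] (A : Matrix m n ℂ) :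
    LinearMap.adjoint A.toEuclideanLin = Aᴴ.toEuclideanLin :=
  (Matrix.toEuclideanLin_conjTranspose_eq_adjoint A).symm

theorem adjoint_apply_of_isometry {m n : Type*} [Fintype m] [Fintype n] [DecidableEq n]
    [DecidableEq m] {U : Matrix m n ℂ} (hU : Uᴴ * U = 1) (x : EuclideanSpace ℂ n) :
    LinearMap.adjoint U.toEuclideanLin (U.toEuclideanLin x) = x := by
  rw [adjoint_toEuclideanLin, ← toEuclideanLin_mul_apply, hU, Matrix.toLpLin_one]
  rfl

theorem norm_conjTranspose_mul_le {V : Matrix (Fin p) (Fin r) ℂ} {Ω : Matrix (Fin p) ι ℂ}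
    {k : ℕ} {ε : ℝ} (hcard : Fintype.card ι ≤ k) (hε0 : 0 ≤ ε)
    (hε : ∀ i, ‖Vᴴ.toEuclideanLin (WithLp.toLp 2 (Ω.col i))‖ ≤ ε) (x : EuclideanSpace ℂ ι) :
    ‖LinearMap.adjoint V.toEuclideanLin (Ω.toEuclideanLin x)‖ ≤ ε * √k * ‖x‖ := by
  rw [adjoint_toEuclideanLin, ← toEuclideanLin_mul_apply]
  exact norm_toEuclideanLin_le hε0 (fun i => by rw [toLp_col_mul]; exact hε i) hcard x

/-- Here `(L + U A Ωᴴ)ᴴ U = V Σ + Ω Aᴴ`. A kernel vector would give a common vector of the ranges of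
`V` and `Ω`, which incoherence excludes unless its `V` coordinate vanishes. No size condition on `A`
is needed, so this serves for the oracle solution and for every optimal one. -/
theorem IsSVD.injective_of_incoherent {L : Matrix (Fin t) (Fin p) ℂ}
    {U : Matrix (Fin t) (Fin r) ℂ} {s : Fin r → ℝ} {V : Matrix (Fin p) (Fin r) ℂ}
    (h : IsSVD L U s V) (A : Matrix (Fin r) ι ℂ) {Ω : Matrix (Fin p) ι ℂ}
    {k : ℕ} {ε σ : ℝ} (hcard : Fintype.card ι ≤ k) (hε0 : 0 ≤ ε)
    (hε : ∀ i, ‖Vᴴ.toEuclideanLin (WithLp.toLp 2 (Ω.col i))‖ ≤ ε)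
    (hσ : ∀ x, ‖x‖ ^ 2 ≤ σ * ‖Ω.toEuclideanLin x‖ ^ 2) (hεσ : ε ^ 2 * k * σ < 1)
    (X : Matrix (Fin r) (Fin r) ℂ) (hX : (L + U * A * Ωᴴ)ᴴ * U * X = 0) : X = 0 := by
  rw [h.conjTranspose_add_mul, Matrix.mul_assoc _ Uᴴ, h.left_orthonormal, Matrix.mul_one,
    Matrix.add_mul, Matrix.mul_assoc, Matrix.mul_assoc] at hX
  have h1 : (diagonal fun i => (s i : ℂ)) * X = 0 := by
    refine ext_toEuclideanLin fun x => ?_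
    have h2 : V.toEuclideanLin (((diagonal fun i => (s i : ℂ)) * X).toEuclideanLin x)
        = Ω.toEuclideanLin (-((Aᴴ * X).toEuclideanLin x)) := by
      rw [map_neg, ← toEuclideanLin_mul_apply, ← toEuclideanLin_mul_apply,
        eq_neg_iff_add_eq_zero, ← LinearMap.add_apply, ← map_add, hX]
      simp
    rw [eq_zero_of_apply_eq_range (adjoint_apply_of_isometry h.right_orthonormal) hσ
      (norm_conjTranspose_mul_le hcard hε0 hε) (by
        rw [mul_pow, Real.sq_sqrt (Nat.cast_nonneg k)]; exact hεσ) h2]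
    simp
  ext i j
  have h2 := congrFun (congrFun h1 i) j
  have h3 : (s i : ℂ) ≠ 0 := by exact_mod_cast (h.pos i).ne'
  simpa [Matrix.diagonal_mul, h3] using h2

-- The oracle multiplier is corrected to `Q` with `Q Ω = Λ` and `Uᴴ Q = Uᴴ N`. Norm preservation by
-- `Q` forces the image into the range of `U`, which later pins down column spaces; the last clause
-- prepares the bound off the support.
set_option maxHeartbeats 1000000 in
theorem IsSVD.exists_dual_certificate {L : Matrix (Fin t) (Fin p) ℂ}
    {U : Matrix (Fin t) (Fin r) ℂ} {s : Fin r → ℝ} {V : Matrix (Fin p) (Fin r) ℂ}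
    (h : IsSVD L U s V) (C : Matrix (Fin t) ι ℂ) {Ω : Matrix (Fin p) ι ℂ}
    {k : ℕ} {ε σ ψ lam : ℝ} (hcard : Fintype.card ι ≤ k) (hε0 : 0 ≤ ε)
    (hε : ∀ i, ‖Vᴴ.toEuclideanLin (WithLp.toLp 2 (Ω.col i))‖ ≤ ε) (hσ0 : 0 ≤ σ)
    (hσ : ∀ x, ‖x‖ ^ 2 ≤ σ * ‖Ω.toEuclideanLin x‖ ^ 2) (hεσ : ε ^ 2 * k * σ < 1)
    (hψ0 : 0 ≤ ψ) (hψ1 : ψ < 1) (hlam : 0 < lam) (hlamψ : lam ^ 2 * k * σ ≤ ψ) :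
    ∃ (A : Matrix (Fin r) ι ℂ) (Q : Matrix (Fin t) (Fin p) ℂ),
      IsContraction Q ∧
      (∀ v, ‖Q.toEuclideanLin v‖ = ‖v‖ →
        (U * Uᴴ).toEuclideanLin (Q.toEuclideanLin v) = Q.toEuclideanLin v) ∧
      (∀ i, ‖WithLp.toLp 2 ((Q * Ω).col i)‖ ≤ lam) ∧
      pairing Q (L + U * A * Ωᴴ) + pairing (Q * Ω) (C - U * A) =
        nuclearNorm (L + U * A * Ωᴴ) + lam * columnSum (C - U * A) ∧
      ∀ (w : EuclideanSpace ℂ (Fin p)) (μ : ℝ), ‖Ωᴴ.toEuclideanLin w‖ ≤ √k * μ →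
        ‖Vᴴ.toEuclideanLin w‖ ≤ ε → ∃ x,
          ‖Q.toEuclideanLin w‖ ≤ lam * (k * σ * μ) + x ∧
          (1 - ε ^ 2 * k * σ) * x ^ 2 ≤ (ε * (1 + k * σ * μ)) ^ 2 := by
  obtain ⟨A, N, Λ, hN, hΛ, hNΛ, hNL, hΛC⟩ := exists_oracle_dual h.left_orthonormal L C Ωᴴ hlam
  rw [conjTranspose_conjTranspose] at hNΛ
  set Lh := L + U * A * Ωᴴ with hLh
  have hULh : U * Uᴴ * Lh = Lh := by
    rw [hLh, Matrix.mul_add, h.left_mul_self, Matrix.mul_assoc U Uᴴ, Matrix.mul_assoc U A,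
      ← Matrix.mul_assoc Uᴴ, h.left_orthonormal, Matrix.one_mul]
  have hinj : ∀ X : Matrix (Fin r) (Fin r) ℂ, Lhᴴ * U * X = 0 → X = 0 :=
    h.injective_of_incoherent A hcard hε0 hε hσ hεσ
  obtain ⟨r₁, U₁, s₁, V₁, h₁, hs₁⟩ := exists_isSVD Lh
  have hU₁ := h₁.mul_conjTranspose_mul_of_injective hULh hinj
  have hNU₁ : Nᴴ * U₁ = V₁ := by
    refine h₁.conjTranspose.mul_eq_of_pairing_eq hN.conjTranspose ?_
    rw [pairing_conjTranspose, hNL, hs₁]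
  set Vt := V₁ * (U₁ᴴ * U) with hVt
  have hNU : Nᴴ * U = Vt := by
    conv_lhs => rw [← hU₁]
    rw [Matrix.mul_assoc U₁, ← Matrix.mul_assoc, hNU₁]
  have hUN : Uᴴ * N = Vtᴴ := by
    rw [← hNU, conjTranspose_mul, conjTranspose_conjTranspose]
  have hVtiso : Vtᴴ * Vt = 1 := by
    calc Vtᴴ * Vt = Uᴴ * U₁ * (V₁ᴴ * V₁) * (U₁ᴴ * U) := by
          simp only [hVt, conjTranspose_mul, conjTranspose_conjTranspose, Matrix.mul_assoc]
      _ = Uᴴ * (U₁ * U₁ᴴ * U) := by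
          rw [h₁.right_orthonormal, Matrix.mul_one]; simp only [Matrix.mul_assoc]
      _ = 1 := by rw [hU₁, h.left_orthonormal]
  have hVtΩ : Vtᴴ * Ω = Uᴴ * Λ := by rw [← hUN, hNΛ]
  obtain ⟨X, hX⟩ := h₁.conjTranspose.left_eq_mul
  -- The row space of the oracle solution lies in `range V + range Ω`, since its adjoint is `(V Σ +
  -- Ω Aᴴ) Uᴴ`.
  have hrange : ∀ f, ∃ a x, Vt.toEuclideanLin f = V.toEuclideanLin a + Ω.toEuclideanLin x := by
    intro f
    refine ⟨(diagonal (fun i => (s i : ℂ)) * (Uᴴ * X * (U₁ᴴ * U))).toEuclideanLin f,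
      (Aᴴ * (Uᴴ * X * (U₁ᴴ * U))).toEuclideanLin f, ?_⟩
    rw [← toEuclideanLin_mul_apply, ← toEuclideanLin_mul_apply, ← LinearMap.add_apply, ← map_add,
      hVt, hX, hLh, h.conjTranspose_add_mul]
    simp only [Matrix.mul_assoc, Matrix.add_mul]
  have hΛΩ : ∀ x, ‖Λ.toEuclideanLin x‖ ^ 2 ≤ ψ * ‖Ω.toEuclideanLin x‖ ^ 2 := by
    intro x
    calc ‖Λ.toEuclideanLin x‖ ^ 2 ≤ lam ^ 2 * k * ‖x‖ ^ 2 := norm_toEuclideanLin_sq_le hΛ hcard x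
      _ ≤ lam ^ 2 * k * (σ * ‖Ω.toEuclideanLin x‖ ^ 2) := by gcongr; exact hσ x
      _ = lam ^ 2 * k * σ * ‖Ω.toEuclideanLin x‖ ^ 2 := by ring
      _ ≤ _ := by gcongr
  obtain ⟨Q', hUQ, hQVt, hQΩ, hQn, hQq⟩ := exists_certificate (U := U.toEuclideanLin)
    (Vt := Vt.toEuclideanLin) (Λ := Λ.toEuclideanLin) (Ω := Ω.toEuclideanLin) hψ0 hψ1
    (adjoint_apply_of_isometry h.left_orthonormal) (adjoint_apply_of_isometry hVtiso)
    (fun x => by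
      rw [adjoint_toEuclideanLin, adjoint_toEuclideanLin, ← toEuclideanLin_mul_apply, hVtΩ,
        toEuclideanLin_mul_apply]) hΛΩ
    (fun x hx => by
      have := hσ x
      rw [hx, norm_zero] at this
      have h2 : ‖x‖ ^ 2 = 0 := le_antisymm (by simpa using this) (sq_nonneg _)
      simpa using h2)
  obtain ⟨Q, rfl⟩ := Matrix.toEuclideanLin.surjective Q'
  have hVtn := norm_sq_eq_adjoint_add (adjoint_apply_of_isometry hVtiso)
  have hQΛ : Q * Ω = Λ := ext_toEuclideanLin fun x => by rw [toEuclideanLin_mul_apply, hQΩ]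
  have hUQ' : Uᴴ * Q = Uᴴ * N := by
    rw [hUN]
    refine ext_toEuclideanLin fun x => ?_
    rw [toEuclideanLin_mul_apply, ← adjoint_toEuclideanLin, hUQ, adjoint_toEuclideanLin]
  refine ⟨A, Q, ?_, ?_, ?_, ?_, ?_⟩
  · intro v
    refine (sq_le_sq₀ (norm_nonneg _) (norm_nonneg _)).1 ?_
    rw [hVtn v]
    have := sq_nonneg ‖v - Vt.toEuclideanLin (LinearMap.adjoint Vt.toEuclideanLin v)‖
    nlinarith [hQn v]
  · intro v hv
    set y := LinearMap.adjoint Vt.toEuclideanLin v with hy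
    have h1 := hQn v
    rw [hv, hVtn v] at h1
    -- The component off the range of `Vt` is shrunk by `ψ < 1`, so equality of norms leaves no such
    -- component.
    have h2 : ‖v - Vt.toEuclideanLin y‖ ^ 2 = 0 := by
      nlinarith [sq_nonneg ‖v - Vt.toEuclideanLin y‖]
    have h3 : v = Vt.toEuclideanLin y := by simpa [sub_eq_zero] using h2
    rw [h3, hQVt, ← toEuclideanLin_mul_apply, Matrix.mul_assoc, h.left_orthonormal, Matrix.mul_one]
  · rw [hQΛ]; exact hΛ
  · rw [hQΛ, hΛC, ← hNL]
    congr 1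
    -- As the columns of `Lh` lie in the range of `U`, the pairing sees only `Uᴴ Z`, on which `Q`
    -- and `N` agree.
    have key : ∀ Z, pairing Z Lh = pairing (Uᴴ * Z) (Uᴴ * Lh) := by
      intro Z
      rw [← pairing_mul_left, ← Matrix.mul_assoc, hULh]
    rw [key Q, key N, hUQ']
  · intro w μ hμ hw
    obtain ⟨b, q, rfl, hq, hb⟩ := exists_add_of_injective hσ0 hσ w
    rw [adjoint_toEuclideanLin] at hb
    have hb' : ‖b‖ ≤ σ * (√k * μ) := hb.trans (by gcongr)
    have hkk : √(k : ℝ) * √k = k := Real.mul_self_sqrt (Nat.cast_nonneg k)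
    refine ⟨‖Q.toEuclideanLin q‖, ?_, ?_⟩
    · rw [map_add, hQΩ]
      refine (norm_add_le _ _).trans (add_le_add_left ?_ _)
      calc ‖Λ.toEuclideanLin b‖ ≤ lam * √k * ‖b‖ := norm_toEuclideanLin_le hlam.le hΛ hcard b
        _ ≤ lam * √k * (σ * (√k * μ)) := by gcongr
        _ = lam * ((√k * √k) * σ * μ) := by ring
        _ = _ := by rw [hkk]
    · obtain ⟨f, x, hf, h1, h2⟩ := hQq q hq
      have h3 := norm_sq_le_of_orthogonal (Vt := Vt.toEuclideanLin) (V := V.toEuclideanLin)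
        (adjoint_apply_of_isometry h.right_orthonormal) hσ hσ0
        (norm_conjTranspose_mul_le hcard hε0 hε) hrange hq h1 h2
      rw [mul_pow, Real.sq_sqrt (Nat.cast_nonneg k)] at h3
      have h4 : ‖LinearMap.adjoint V.toEuclideanLin q‖ ≤ ε * (1 + k * σ * μ) := by
        have h5 : LinearMap.adjoint V.toEuclideanLin q =
            Vᴴ.toEuclideanLin (Ω.toEuclideanLin b + q) -
              LinearMap.adjoint V.toEuclideanLin (Ω.toEuclideanLin b) := by
          rw [← adjoint_toEuclideanLin, map_add]; abel
        rw [h5]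
        refine (norm_sub_le _ _).trans ?_
        have h6 : ε + ε * √k * ‖b‖ ≤ ε + ε * √k * (σ * (√k * μ)) := by gcongr
        refine (add_le_add hw (norm_conjTranspose_mul_le hcard hε0 hε b)).trans (h6.trans_eq ?_)
        calc ε + ε * √k * (σ * (√k * μ)) = ε * (1 + (√k * √k) * σ * μ) := by ring
          _ = _ := by rw [hkk]
      calc (1 - ε ^ 2 * k * σ) * ‖Q.toEuclideanLin q‖ ^ 2
          ≤ (1 - ε ^ 2 * k * σ) * (inner ℂ f (LinearMap.adjoint Vt.toEuclideanLin q)).re := by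
            gcongr
        _ ≤ ‖LinearMap.adjoint V.toEuclideanLin q‖ ^ 2 := h3
        _ ≤ _ := by gcongr

end Rank

/-! ### Optimality, complementary slackness and identification of the attack. -/

section Recovery

variable {t p n r : ℕ}

theorem mem_columnSupport {m n : ℕ} {A : Matrix (Fin m) (Fin n) ℂ} {j : Fin n} :
    j ∈ columnSupport A ↔ A.col j ≠ 0 := by
  simp [columnSupport]

theorem notMem_columnSupport {m n : ℕ} {A : Matrix (Fin m) (Fin n) ℂ} {j : Fin n} :
    j ∉ columnSupport A ↔ A.col j = 0 := by
  rw [mem_columnSupport, not_not]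

theorem sum_coe_eq_sum {M : Type*} [AddCommMonoid M] {I : Finset (Fin n)} (f : Fin n → M)
    (h : ∀ j, j ∉ I → f j = 0) : ∑ i : I, f i = ∑ j, f j := by
  rw [Finset.sum_coe_sort I f]
  exact Finset.sum_subset (Finset.subset_univ I) fun j _ hj => h j hj

theorem col_eq_zero_of_columnSupport_subset {m : ℕ} {A : Matrix (Fin m) (Fin n) ℂ}
    {I : Finset (Fin n)} (hA : columnSupport A ⊆ I) {j : Fin n} (hj : j ∉ I) : A.col j = 0 :=
  notMem_columnSupport.1 fun h => hj (hA h)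

theorem mul_transpose_eq_columns {A : Matrix (Fin t) (Fin n) ℂ} {I : Finset (Fin n)}
    (hA : columnSupport A ⊆ I) (W : Matrix (Fin p) (Fin n) ℂ) :
    A * Wᵀ = columns A I * (columns W I)ᵀ := by
  ext a b
  rw [Matrix.mul_apply, Matrix.mul_apply]
  refine (sum_coe_eq_sum (I := I) (fun j => A a j * Wᵀ j b) fun j hj => ?_).symm
  have : A a j = 0 := congrFun (col_eq_zero_of_columnSupport_subset hA hj) a
  rw [this, zero_mul]

theorem norm12_eq_columnSum_columns {A : Matrix (Fin t) (Fin n) ℂ} {I : Finset (Fin n)}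
    (hA : columnSupport A ⊆ I) : norm12 A = columnSum (columns A I) := by
  refine (sum_coe_eq_sum (I := I) (fun j => colNorm A j) fun j hj => ?_).symm
  rw [colNorm, col_eq_zero_of_columnSupport_subset hA hj]
  simp

theorem pairing_eq_pairing_columns {A : Matrix (Fin t) (Fin n) ℂ} {I : Finset (Fin n)}
    (hA : columnSupport A ⊆ I) (X : Matrix (Fin t) (Fin n) ℂ) :
    pairing X A = pairing (columns X I) (columns A I) := by
  rw [pairing_eq_sum, pairing_eq_sum]
  refine (sum_coe_eq_sum (I := I) (fun j => (inner ℂ (WithLp.toLp 2 (X.col j))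
    (WithLp.toLp 2 (A.col j))).re) fun j hj => ?_).symm
  rw [col_eq_zero_of_columnSupport_subset hA hj]
  simp

theorem conjTranspose_map_star {m n : Type*} (A : Matrix m n ℂ) : (A.map star)ᴴ = Aᵀ := by
  ext i j
  simp

theorem pairing_mul_transpose (Q : Matrix (Fin t) (Fin p) ℂ) (C : Matrix (Fin t) (Fin n) ℂ)
    (W : Matrix (Fin p) (Fin n) ℂ) : pairing Q (C * Wᵀ) = pairing (Q * W.map star) C := by
  rw [pairing_mul_right]
  rfl

/-- Sufficiency of a dual certificate, with complementary slackness for every optimal solution. -/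
theorem isOptimal_of_certificate {M L : Matrix (Fin t) (Fin p) ℂ} {C : Matrix (Fin t) (Fin n) ℂ}
    {W : Matrix (Fin p) (Fin n) ℂ} {lam : ℝ} {Q : Matrix (Fin t) (Fin p) ℂ}
    (hQ : IsContraction Q)
    (hcol : ∀ j, ‖WithLp.toLp 2 ((Q * W.map star).col j)‖ ≤ lam) (hfeas : M = L + C * Wᵀ)
    (hval : pairing Q L + pairing (Q * W.map star) C = nuclearNorm L + lam * norm12 C) :
    IsOptimal M W lam L C ∧ ∀ L' C', IsOptimal M W lam L' C' →
      pairing Q L' = nuclearNorm L' ∧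
      ∀ j, (inner ℂ (WithLp.toLp 2 ((Q * W.map star).col j)) (WithLp.toLp 2 (C'.col j))).re
        = lam * colNorm C' j := by
  have hterm : ∀ (C' : Matrix (Fin t) (Fin n) ℂ) (j : Fin n),
      (inner ℂ (WithLp.toLp 2 ((Q * W.map star).col j)) (WithLp.toLp 2 (C'.col j))).re
        ≤ lam * colNorm C' j := fun C' j =>
    (re_inner_le _ _).trans (mul_le_mul_of_nonneg_right (hcol j) (norm_nonneg _))
  have hsum : ∀ C' : Matrix (Fin t) (Fin n) ℂ, pairing (Q * W.map star) C' ≤ lam * norm12 C' := by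
    intro C'
    rw [pairing_eq_sum, norm12, Finset.mul_sum]
    exact Finset.sum_le_sum fun j _ => hterm C' j
  -- The lower bound given by `Q` is the same number at every feasible point, so attaining it once
  -- makes it tight at every optimum.
  have hM : ∀ (L' : Matrix (Fin t) (Fin p) ℂ) (C' : Matrix (Fin t) (Fin n) ℂ), M = L' + C' * Wᵀ →
      pairing Q L' + pairing (Q * W.map star) C' = pairing Q M := by
    rintro L' C' rfl
    rw [pairing_add_right, pairing_mul_transpose]
  rw [hM L C hfeas] at hval
  refine ⟨⟨hfeas, fun L' C' h' => ?_⟩, fun L' C' hopt => ?_⟩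
  · have h1 := pairing_le_nuclearNorm hQ L'
    have h2 := hsum C'
    have h3 := hM L' C' h'
    linarith
  · have h1 := pairing_le_nuclearNorm hQ L'
    have h2 := hsum C'
    have h3 := hM L' C' hopt.feasible
    have h4 := hopt.minimal L C hfeas
    refine ⟨by linarith, ?_⟩
    have h5 : pairing (Q * W.map star) C' = lam * norm12 C' := by linarith
    rw [pairing_eq_sum, norm12, Finset.mul_sum,
      Finset.sum_eq_sum_iff_of_le fun j _ => hterm C' j] at h5
    exact fun j => h5 j (Finset.mem_univ j)

/-- The numerical inequality behind the threshold `λ_min`. -/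
theorem mul_add_lt_of_incoherent {b s ε lam τ x : ℝ} (hb : 3 / 2 ≤ b) (hs : 0 ≤ s)
    (hbs : b * s < 1) (hε0 : 0 ≤ ε) (hε : b * ε ≤ lam * (1 - b * s)) (hlam : 0 < lam)
    (hτ : b ^ 2 * τ ≤ 1) (hx : (1 - τ) * x ^ 2 ≤ (ε * (1 + s)) ^ 2) :
    lam * s + x < lam := by
  by_contra hcon
  push Not at hcon
  have hs1 : s < 2 / 3 := by nlinarith
  have h1 : lam * (1 - s) ≤ x := by linarith
  have h2 : (lam * (1 - s)) ^ 2 ≤ x ^ 2 :=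
    pow_le_pow_left₀ (mul_nonneg hlam.le (by linarith)) h1 2
  have h3 : (b ^ 2 - 1) * x ^ 2 ≤ (b * ε * (1 + s)) ^ 2 := by
    have h4 := mul_le_mul_of_nonneg_left hx (sq_nonneg b)
    nlinarith [sq_nonneg x]
  -- The factor `11/10` works because `(11/10)² < 5/4 ≤ b² - 1`. In the worst case `b = 3/2` the
  -- inequality says that `1/10 - 3s/5 + 3s²/2` is positive, with minimum at `s = 1/5`.
  have h5 : (1 - b * s) * (1 + s) < 11 / 10 * (1 - s) := by
    nlinarith [sq_nonneg (s - 1 / 5), mul_nonneg hs (sub_nonneg.2 hb),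
      mul_nonneg (mul_nonneg hs hs) (sub_nonneg.2 hb)]
  have h6 : b * ε * (1 + s) ≤ lam * (11 / 10 * (1 - s)) := by
    calc b * ε * (1 + s) ≤ lam * (1 - b * s) * (1 + s) := by gcongr
      _ = lam * ((1 - b * s) * (1 + s)) := by ring
      _ ≤ _ := by gcongr
  have h7 : (b * ε * (1 + s)) ^ 2 ≤ (lam * (11 / 10 * (1 - s))) ^ 2 :=
    pow_le_pow_left₀ (by positivity) h6 2
  have h8 : 5 / 4 ≤ b ^ 2 - 1 := by nlinarith
  have h9 : 0 < (lam * (1 - s)) ^ 2 := by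
    have : 0 < 1 - s := by linarith
    positivity
  have h10 : 5 / 4 * (lam * (1 - s)) ^ 2 ≤ (b ^ 2 - 1) * x ^ 2 :=
    mul_le_mul h8 h2 h9.le (by linarith)
  nlinarith

theorem mul_conjTranspose_eq_of_mul_left {r' : ℕ} {U : Matrix (Fin t) (Fin r) ℂ} {U' : Matrix (Fin t) (Fin r') ℂ}
    (h1 : U' * U'ᴴ * U = U) (h2 : U * Uᴴ * U' = U') : U' * U'ᴴ = U * Uᴴ := by
  have h3 : U * Uᴴ * (U' * U'ᴴ) = U' * U'ᴴ := by rw [← Matrix.mul_assoc, h2]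
  have h4 : U' * U'ᴴ * (U * Uᴴ) = U * Uᴴ := by rw [← Matrix.mul_assoc, h1]
  have h5 := congrArg Matrix.conjTranspose h4
  simp only [conjTranspose_mul, conjTranspose_conjTranspose] at h5
  rw [← h3, h5]

theorem IsSVD.col_mem_columnSpace {L X : Matrix (Fin t) (Fin p) ℂ} {U : Matrix (Fin t) (Fin r) ℂ}
    {s : Fin r → ℝ} {V : Matrix (Fin p) (Fin r) ℂ} (h : IsSVD L U s V) (hX : U * Uᴴ * X = X)
    (j : Fin p) : X.col j ∈ columnSpace L := by
  obtain ⟨Y, hY⟩ := h.left_eq_mul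
  rw [columnSpace, ← Matrix.range_mulVecLin]
  refine ⟨(Y * Uᴴ * X).col j, ?_⟩
  have h1 : L * (Y * Uᴴ * X) = X := by
    rw [← Matrix.mul_assoc, ← Matrix.mul_assoc, ← hY, hX]
  conv_rhs => rw [← h1]
  ext i
  simp [Matrix.mulVec, dotProduct, Matrix.mul_apply]

theorem IsSVD.mul_self_of_pairing_eq {L : Matrix (Fin t) (Fin p) ℂ}
    {Q : Matrix (Fin t) (Fin p) ℂ} (hQ : IsContraction Q) {U : Matrix (Fin t) (Fin r) ℂ}
    (hQU : ∀ v, ‖Q.toEuclideanLin v‖ = ‖v‖ →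
      (U * Uᴴ).toEuclideanLin (Q.toEuclideanLin v) = Q.toEuclideanLin v)
    (hQL : pairing Q L = nuclearNorm L) : U * Uᴴ * L = L := by
  obtain ⟨r₁, U₁, s₁, V₁, h₁, hs₁⟩ := exists_isSVD L
  have hQV := h₁.mul_eq_of_pairing_eq hQ (hQL.trans hs₁)
  have hU₁ : U * Uᴴ * U₁ = U₁ := by
    ext a i
    have h1 : Q.toEuclideanLin (WithLp.toLp 2 (V₁.col i)) = WithLp.toLp 2 (U₁.col i) := by
      rw [← toLp_col_mul, hQV]
    have h2 := hQU (WithLp.toLp 2 (V₁.col i)) (by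
      rw [h1, norm_col_of_isometry h₁.left_orthonormal, norm_col_of_isometry h₁.right_orthonormal])
    rw [h1, ← toLp_col_mul] at h2
    simpa using congrArg (fun v => v.ofLp a) h2
  rw [h₁.eq, ← Matrix.mul_assoc, ← Matrix.mul_assoc, hU₁]

/-- If `C' Wᵀ` vanishes in a channel, then the column of `C Wᵀ` there is a difference of two vectors
in the column space of `L`, so it is zero by `hD`. The reverse inclusion needs only that `C'` is
supported where `C` is. -/
theorem columnSupport_mul_transpose_conclusions {L L' : Matrix (Fin t) (Fin p) ℂ}
    {C C' : Matrix (Fin t) (Fin n) ℂ} {W : Matrix (Fin p) (Fin n) ℂ}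
    {U : Matrix (Fin t) (Fin r) ℂ} {s : Fin r → ℝ} {V : Matrix (Fin p) (Fin r) ℂ}
    (h : IsSVD L U s V)
    (hD : ∀ j, (C * Wᵀ).col j ≠ 0 → (C * Wᵀ).col j ∉ columnSpace L)
    (hfeas : L + C * Wᵀ = L' + C' * Wᵀ) (hUL' : U * Uᴴ * L' = L')
    (hC' : columnSupport C' ⊆ columnSupport C) :
    columnSupport (C * Wᵀ) ⊆ columnSupport (C' * Wᵀ) ∧
      (∀ j, j ∉ columnSupport (C' * Wᵀ) → L'.col j = L.col j) ∧
      ((∀ j, (∃ i ∈ columnSupport C, W j i ≠ 0) → (C * Wᵀ).col j ≠ 0) →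
        columnSupport (C' * Wᵀ) = columnSupport (C * Wᵀ)) := by
  have hcol : ∀ j, L.col j + (C * Wᵀ).col j = L'.col j + (C' * Wᵀ).col j := fun j => by
    ext a
    exact congrFun (congrFun hfeas a) j
  have hsub : columnSupport (C * Wᵀ) ⊆ columnSupport (C' * Wᵀ) := by
    intro j hj
    rw [mem_columnSupport] at hj ⊢
    intro h0
    refine hD j hj ?_
    have h1 := hcol j
    rw [h0, add_zero] at h1
    have h2 : (C * Wᵀ).col j = L'.col j - L.col j := by rw [← h1]; abel
    rw [h2]
    exact Submodule.sub_mem _ (h.col_mem_columnSpace hUL' j)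
      (h.col_mem_columnSpace h.left_mul_self j)
  refine ⟨hsub, fun j hj => ?_, fun hnc => subset_antisymm (fun j hj => ?_) hsub⟩
  · have h1 := hcol j
    rw [notMem_columnSupport.1 hj, notMem_columnSupport.1 fun h' => hj (hsub h'), add_zero,
      add_zero] at h1
    exact h1.symm
  · rw [mem_columnSupport] at hj ⊢
    refine hnc j ?_
    by_contra hcon
    push Not at hcon
    refine hj ?_
    ext a
    simp only [Matrix.col_apply, Matrix.mul_apply, Matrix.transpose_apply, Pi.zero_apply]
    refine Finset.sum_eq_zero fun i _ => ?_
    by_cases hi : i ∈ columnSupport C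
    · rw [hcon i hi, mul_zero]
    · have : C' a i = 0 := congrFun (col_eq_zero_of_columnSupport_subset hC' hi) a
      rw [this, zero_mul]

/-- For a positive parameter below the thresholds there is an optimal solution, and every optimal
solution has its columns in the range of `U` and the right supports. -/
theorem IsSVD.exists_isOptimal {L : Matrix (Fin t) (Fin p) ℂ} {C : Matrix (Fin t) (Fin n) ℂ}
    {W : Matrix (Fin p) (Fin n) ℂ} {U : Matrix (Fin t) (Fin r) ℂ} {s : Fin r → ℝ}
    {V : Matrix (Fin p) (Fin r) ℂ} (h : IsSVD L U s V) (hW : ∀ j, colNorm W j = 1)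
    {ψ : ℝ} (hψ0 : 0 ≤ ψ) (hψ1 : ψ < 1) {k : ℕ} (hkμ : k * coherence W < 1)
    (hsupp : (columnSupport C).card ≤ k) {b lam : ℝ} (hb : 3 / 2 ≤ b)
    (hbs : b * (k * sigma W k * coherence W) < 1)
    (hlamε : b * eps V W ≤ lam * (1 - b * (k * sigma W k * coherence W)))
    (hlam : 0 < lam) (hlamψ : lam ^ 2 * k * sigma W k ≤ ψ) :
    (∃ L' C', IsOptimal (L + C * Wᵀ) W lam L' C') ∧
      ∀ L' C', IsOptimal (L + C * Wᵀ) W lam L' C' →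
        U * Uᴴ * L' = L' ∧ columnSupport C' ⊆ columnSupport C ∧
        ∀ X : Matrix (Fin r) (Fin r) ℂ, L'ᴴ * U * X = 0 → X = 0 := by
  classical
  set I := columnSupport C with hI
  set σ := sigma W k with hσdef
  set μ := coherence W with hμdef
  set ε := eps V W with hεdef
  set Ω := (columns W I).map star with hΩ
  have hσ0 : 0 ≤ σ := sigma_nonneg W k
  have hμ0 : 0 ≤ μ := coherence_nonneg W
  have hε0 : 0 ≤ ε := eps_nonneg V W
  have hs0 : 0 ≤ k * σ * μ := by positivity
  have hcard : Fintype.card I ≤ k := by simpa using hsupp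
  have hε : ∀ i, ‖Vᴴ.toEuclideanLin (WithLp.toLp 2 (Ω.col i))‖ ≤ ε :=
    fun i => norm_col_le_eps V W i
  have hσ : ∀ x, ‖x‖ ^ 2 ≤ σ * ‖Ω.toEuclideanLin x‖ ^ 2 :=
    norm_sq_le_sigma_mul_map_star hW hkμ hsupp
  have hbε : b * ε ≤ lam := by
    have : 0 ≤ lam * (b * (k * σ * μ)) := by positivity
    linarith
  have hτ : b ^ 2 * (ε ^ 2 * k * σ) ≤ ψ := by
    calc b ^ 2 * (ε ^ 2 * k * σ) = (b * ε) ^ 2 * k * σ := by ring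
      _ ≤ lam ^ 2 * k * σ := by gcongr
      _ ≤ ψ := hlamψ
  have hεσ : ε ^ 2 * k * σ < 1 := by
    have : 0 ≤ ε ^ 2 * k * σ := by positivity
    nlinarith
  obtain ⟨A, Q, hQ, hQU, hQΩ, hval, hoff⟩ := h.exists_dual_certificate (columns C I) hcard hε0 hε
    hσ0 hσ hεσ hψ0 hψ1 hlam hlamψ
  have hoff' : ∀ j, j ∉ I → ‖WithLp.toLp 2 ((Q * W.map star).col j)‖ < lam := by
    intro j hj
    obtain ⟨x, hx1, hx2⟩ := hoff (WithLp.toLp 2 ((W.map star).col j)) μ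
      (norm_gram_col_le W hsupp hj) (norm_col_le_eps V W j)
    rw [toLp_col_mul]
    exact hx1.trans_lt
      (mul_add_lt_of_incoherent hb hs0 hbs hε0 hlamε hlam (hτ.trans hψ1.le) hx2)
  have hcol : ∀ j, ‖WithLp.toLp 2 ((Q * W.map star).col j)‖ ≤ lam := by
    intro j
    by_cases hj : j ∈ I
    · exact hQΩ ⟨j, hj⟩
    · exact (hoff' j hj).le
  have hΩH : Ωᴴ = (columns W I)ᵀ := conjTranspose_map_star _
  rw [hΩH] at hval
  set A' : Matrix (Fin r) (Fin n) ℂ := Matrix.of fun a j => if hj : j ∈ I then A a ⟨j, hj⟩ else 0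
    with hA'
  have hA'0 : ∀ j, j ∉ I → A'.col j = 0 := by
    intro j hj
    ext a
    simp [hA', hj]
  have hA'I : columns A' I = A := by
    ext a j
    simp [columns, hA']
  have hA's : columnSupport A' ⊆ I := fun j hj => by
    by_contra hjI
    exact mem_columnSupport.1 hj (hA'0 j hjI)
  set Ch := C - U * A' with hCh
  have hChs : columnSupport Ch ⊆ I := by
    intro j hj
    by_contra hjI
    refine mem_columnSupport.1 hj ?_
    ext a
    have h1 : C a j = 0 := congrFun (notMem_columnSupport.1 hjI) a
    have h2 : ∀ x, A' x j = 0 := fun x => congrFun (hA'0 j hjI) x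
    simp [hCh, h1, Matrix.mul_apply, h2]
  have hChI : columns Ch I = columns C I - U * A := by
    rw [← hA'I]
    rfl
  have hfeas : L + C * Wᵀ = (L + U * A * (columns W I)ᵀ) + Ch * Wᵀ := by
    rw [hCh, Matrix.sub_mul, Matrix.mul_assoc U A', mul_transpose_eq_columns hA's W, hA'I,
      Matrix.mul_assoc U A]
    abel
  obtain ⟨hopt, hall⟩ := isOptimal_of_certificate hQ hcol hfeas (by
    rw [norm12_eq_columnSum_columns hChs, pairing_eq_pairing_columns hChs, hChI]
    exact hval)
  refine ⟨⟨_, _, hopt⟩, fun L' C' hL' => ?_⟩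
  obtain ⟨hQL', hQC'⟩ := hall L' C' hL'
  have hUL' : U * Uᴴ * L' = L' := IsSVD.mul_self_of_pairing_eq hQ hQU hQL'
  have hC's : columnSupport C' ⊆ I := by
    intro j hj
    by_contra hjI
    have h1 : 0 < colNorm C' j := by
      rw [colNorm, norm_pos_iff]
      simpa using mem_columnSupport.1 hj
    have h2 := re_inner_le (WithLp.toLp 2 ((Q * W.map star).col j)) (WithLp.toLp 2 (C'.col j))
    rw [hQC' j] at h2
    exact absurd (le_of_mul_le_mul_right h2 h1) (not_le.2 (hoff' j hjI))
  refine ⟨hUL', hC's, ?_⟩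
  -- Feasibility puts `L' - L` in the form `X Ωᴴ`, and `U Uᴴ` fixes it, so the rank argument applies
  -- to any optimal solution.
  have hdiff : L' = L + U * (Uᴴ * (columns C I - columns C' I)) * Ωᴴ := by
    have h1 : L' - L = (columns C I - columns C' I) * Ωᴴ := by
      rw [Matrix.sub_mul, hΩH, ← mul_transpose_eq_columns subset_rfl W,
        ← mul_transpose_eq_columns hC's W, sub_eq_sub_iff_add_eq_add, add_comm _ L,
        hL'.feasible]
    have h2 : U * Uᴴ * (L' - L) = L' - L := by rw [Matrix.mul_sub, hUL', h.left_mul_self]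
    rw [← Matrix.mul_assoc, Matrix.mul_assoc (U * Uᴴ), ← h1, h2]
    abel
  rw [hdiff]
  exact h.injective_of_incoherent _ hcard hε0 hε hσ hεσ

open scoped ComplexOrder in
/-- If the row space of `L` is orthogonal to `W`, then the nuclear norm alone identifies `L`. -/
theorem IsSVD.isOptimal_zero {L : Matrix (Fin t) (Fin p) ℂ} {C : Matrix (Fin t) (Fin n) ℂ}
    {W : Matrix (Fin p) (Fin n) ℂ} {U : Matrix (Fin t) (Fin r) ℂ} {s : Fin r → ℝ}
    {V : Matrix (Fin p) (Fin r) ℂ} (h : IsSVD L U s V) (hVW : Vᴴ * W.map star = 0) :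
    IsOptimal (L + C * Wᵀ) W 0 L C ∧
      ∀ L' C', IsOptimal (L + C * Wᵀ) W 0 L' C' → L' = L ∧ C' * Wᵀ = C * Wᵀ := by
  have hQW : U * Vᴴ * W.map star = 0 := by rw [Matrix.mul_assoc, hVW, Matrix.mul_zero]
  obtain ⟨hopt, hall⟩ := isOptimal_of_certificate (M := L + C * Wᵀ) (L := L) (C := C) (W := W)
    (lam := 0) h.mul_conjTranspose_isContraction
    (fun j => by
      rw [hQW]
      have : WithLp.toLp 2 ((0 : Matrix (Fin t) (Fin n) ℂ).col j) = 0 := by ext; simp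
      rw [this, norm_zero]) rfl
    (by rw [hQW, h.pairing_mul_conjTranspose, h.nuclearNorm_eq]; simp [pairing])
  refine ⟨hopt, fun L' C' hL' => ?_⟩
  obtain ⟨r₁, U₁, s₁, V₁, h₁, hs₁⟩ := exists_isSVD L'
  -- Tightness of `U Vᴴ` at `L'` puts the row space of `L'` inside that of `L`, hence orthogonal to
  -- `W`.
  have h1 : Vᴴᴴ * Uᴴ * U₁ = V₁ := by
    have := h₁.conjTranspose.mul_eq_of_pairing_eq (Q := (U * Vᴴ)ᴴ)
      h.mul_conjTranspose_isContraction.conjTranspose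
      (by rw [pairing_conjTranspose, (hall L' C' hL').1, hs₁])
    rwa [conjTranspose_mul] at this
  have h2 : L' * W.map star = 0 := by
    rw [h₁.eq, ← h1]
    simp only [conjTranspose_mul, conjTranspose_conjTranspose, Matrix.mul_assoc, hVW,
      Matrix.mul_zero]
  have h3 : L * W.map star = 0 := by
    rw [h.eq]
    simp only [Matrix.mul_assoc, hVW, Matrix.mul_zero]
  have h4 : L' - L = (C - C') * Wᵀ := by
    rw [Matrix.sub_mul, sub_eq_sub_iff_add_eq_add, add_comm _ L, hL'.feasible]
  -- The difference factors through `Wᵀ` and annihilates `W‡`, so it is orthogonal to itself.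
  have h5 : (L' - L) * (L' - L)ᴴ = 0 := by
    have h6 : (L' - L)ᴴ = W.map star * (C - C')ᴴ := by
      rw [h4, conjTranspose_mul]
      rfl
    rw [h6, ← Matrix.mul_assoc, Matrix.sub_mul, h2, h3, sub_self, Matrix.zero_mul]
  rw [Matrix.self_mul_conjTranspose_eq_zero] at h5
  refine ⟨sub_eq_zero.1 h5, ?_⟩
  rw [h4, Matrix.sub_mul, sub_eq_zero] at h5
  exact h5.symm

end Recovery
end AttackId

/-! ### The theorem: the cases of zero and positive parameter. -/

theorem theorem1 {t p n r : ℕ}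
    (Lbar : Matrix (Fin t) (Fin p) ℂ) (Cbar : Matrix (Fin t) (Fin n) ℂ)
    (W : Matrix (Fin p) (Fin n) ℂ)
    (Ubar : Matrix (Fin t) (Fin r) ℂ) (sbar : Fin r → ℝ) (Vbar : Matrix (Fin p) (Fin r) ℂ)
    (hsvd : AttackId.IsSVD Lbar Ubar sbar Vbar)
    (hW : ∀ j, AttackId.colNorm W j = 1)
    (hD : ∀ j, (Cbar * W.transpose).col j ≠ 0 →
      (Cbar * W.transpose).col j ∉ AttackId.columnSpace Lbar)
    (ψ c : ℝ) (hψ : ψ ∈ Set.Ioo (0 : ℝ) 1) (hc : c ∈ Set.Ioo (0 : ℝ) 1)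
    (hψc : (2 - ψ) * √ψ / (1 - ψ) ≤ √((1 + c) / (1 - c)))
    (k : ℕ) (hk : 1 ≤ k)
    (hkc : k * AttackId.coherence W ≤ c)
    (hden : 0 < AttackId.lambdaMinDenom ψ W k)
    (hlam : AttackId.lambdaMin ψ Vbar W k ≤ AttackId.lambdaMax ψ W k)
    (hsupp : (AttackId.columnSupport Cbar).card ≤ k)
    (lam : ℝ)
    (hmem : lam ∈ Set.Icc (AttackId.lambdaMin ψ Vbar W k) (AttackId.lambdaMax ψ W k)) :
    (∃ (L : Matrix (Fin t) (Fin p) ℂ) (C : Matrix (Fin t) (Fin n) ℂ),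
      AttackId.IsOptimal (Lbar + Cbar * W.transpose) W lam L C) ∧
    ∀ (Lstar : Matrix (Fin t) (Fin p) ℂ) (Cstar : Matrix (Fin t) (Fin n) ℂ),
      AttackId.IsOptimal (Lbar + Cbar * W.transpose) W lam Lstar Cstar →
      (∀ (r' : ℕ) (Ustar : Matrix (Fin t) (Fin r') ℂ) (sstar : Fin r' → ℝ)
        (Vstar : Matrix (Fin p) (Fin r') ℂ), AttackId.IsSVD Lstar Ustar sstar Vstar →
        Ustar * Ustar.conjTranspose = Ubar * Ubar.conjTranspose) ∧
      AttackId.columnSupport (Cbar * W.transpose) ⊆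
        AttackId.columnSupport (Cstar * W.transpose) ∧
      (∀ j, j ∉ AttackId.columnSupport (Cstar * W.transpose) → Lstar.col j = Lbar.col j) ∧
      ((∀ j, (∃ i ∈ AttackId.columnSupport Cbar, W j i ≠ 0) →
          (Cbar * W.transpose).col j ≠ 0) →
        AttackId.columnSupport (Cstar * W.transpose) =
          AttackId.columnSupport (Cbar * W.transpose)) := by
  obtain ⟨hψ0, hψ1⟩ := hψ
  obtain ⟨hlam1, hlam2⟩ := hmem
  -- Of the factor `1 + (2 - ψ)⁻¹`, only the lower bound `3/2` enters the estimates.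
  have hinv : 1 / 2 ≤ (2 - ψ)⁻¹ := by
    rw [← one_div]
    exact one_div_le_one_div_of_le (by linarith) (by linarith)
  set b : ℝ := 1 + (2 - ψ)⁻¹ with hb
  have hb' : 3 / 2 ≤ b := by linarith
  have hden' : AttackId.lambdaMinDenom ψ W k =
      1 - b * (k * AttackId.sigma W k * AttackId.coherence W) := by
    rw [AttackId.lambdaMinDenom]
    ring
  have hlamε : b * AttackId.eps Vbar W ≤
      lam * (1 - b * (k * AttackId.sigma W k * AttackId.coherence W)) := by
    rw [← hden', ← div_le_iff₀ hden]
    exact hlam1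
  have hε0 := AttackId.eps_nonneg Vbar W
  have hlam0 : 0 ≤ lam :=
    le_trans (div_nonneg (mul_nonneg (by linarith) hε0) hden.le) hlam1
  rcases hlam0.eq_or_lt with rfl | hpos
  · have hε : AttackId.eps Vbar W = 0 := by nlinarith
    have hVW : Vbar.conjTranspose * W.map star = 0 := by
      ext i j
      have h1 := AttackId.norm_col_le_eps Vbar W j
      rw [hε, ← AttackId.toLp_col_mul, norm_le_zero_iff] at h1
      simpa using congrArg (fun v => v.ofLp i) h1
    obtain ⟨hopt, hall⟩ := hsvd.isOptimal_zero (C := Cbar) hVW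
    refine ⟨⟨_, _, hopt⟩, fun Lstar Cstar hstar => ?_⟩
    obtain ⟨rfl, hC⟩ := hall Lstar Cstar hstar
    rw [hC]
    refine ⟨fun r' Ustar sstar Vstar h' => ?_, subset_rfl, fun _ _ => rfl, fun _ => rfl⟩
    exact AttackId.mul_conjTranspose_eq_of_mul_left
      (hsvd.mul_conjTranspose_mul_left h'.left_mul_self)
      (h'.mul_conjTranspose_mul_left hsvd.left_mul_self)
  · have hlamψ : lam ^ 2 * k * AttackId.sigma W k ≤ ψ := by
      have h1 : 0 < ψ / (k * AttackId.sigma W k) := Real.sqrt_pos.1 (hpos.trans_le hlam2)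
      -- Division by zero yields `0`, so a vanishing `k σ` would make `λ_max` zero, contrary to `λ >
      -- 0`.
      have h2 : 0 < k * AttackId.sigma W k := by
        by_contra hcon
        exact absurd (div_nonpos_of_nonneg_of_nonpos hψ0.le (not_lt.1 hcon)) (not_le.2 h1)
      have h3 : lam ^ 2 ≤ ψ / (k * AttackId.sigma W k) := (Real.le_sqrt' hpos).1 hlam2
      rw [le_div_iff₀ h2] at h3
      linarith
    obtain ⟨hex, hall⟩ := hsvd.exists_isOptimal (C := Cbar) hW hψ0.le hψ1 (hkc.trans_lt hc.2) hsupp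
      hb' (by linarith) hlamε hpos hlamψ
    refine ⟨hex, fun Lstar Cstar hstar => ?_⟩
    obtain ⟨hUL, hCsupp, hinj⟩ := hall Lstar Cstar hstar
    refine ⟨fun r' Ustar sstar Vstar h' => ?_,
      AttackId.columnSupport_mul_transpose_conclusions hsvd hD hstar.feasible hUL hCsupp⟩
    exact AttackId.mul_conjTranspose_eq_of_mul_left
      (h'.mul_conjTranspose_mul_of_injective hUL hinj) (h'.mul_conjTranspose_mul_left hUL)
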